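/- Let $d\ge 1$, $m\ge 2$, and let $\mathbf P$ be a probability law of $(X,Y)$ on $\mathbb R^d\times\{1,\dots,m\}$ with marginal $\mathbf P_X$ and conditional label probabilities $\eta_j(X)=\mathbf P(Y=j\mid X)$. For a classifier $f$ put $R(f)=\mathbf P(Y\ne f(X))$, and let $f^*(x)\in\arg\max_j\eta_j(x)$ be a Bayes classifier. Let $\beta,L>0$, and let $\lfloor\beta\rfloor$ be the integer part of $\beta$ (if $\beta$ is an integer, it may be read either as $\beta$ or as the largest integer strictly less than $\beta$, the same one throughout). Assume: * (Hölder) every $\eta_j:\mathbb R^d\to\mathbb R$ is $\lfloor\beta\rfloor$ times continuously differentiable and $|\eta_j(x')-\eta_{j,x}(x')|\le L\|x-x'\|^\beta$ for all $x,x'\in\mathbb R^d$, where $\eta_{j,x}$ is the Taylor polynomial of $\eta_j$ at $x$ of degree $\lfloor\beta\rfloor$; * (strong density) there are $c_0,r_0>0$, $0<\mu_{\min}<\mu_{\max}<\infty$, a compact set $\mathcal C\subset\mathbb R^d$ and a compact set $A\subseteq\mathcal C$ with $\lambda[A\cap B(x,r)]\ge c_0\lambda[B(x,r)]$ for all $x\in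 A$, $0<r\le r_0$ ($\lambda$ is Lebesgue measure), such that $\mathbf P_X$ has a Lebesgue density with values in $[\mu_{\min},\mu_{\max}]$ on $A$ and equal to $0$ off $A$; * (margin) there are $C_0>0$, $\alpha\ge 0$ with $\mathbf P_X(\eta_{(1)}(X)-\eta_{(2)}(X)\le t)\le C_0t^\alpha$ for all $t>0$, where $\eta_{(1)}(x)\ge\eta_{(2)}(x)$ are the two largest of $\eta_1(x),\dots,\eta_m(x)$, counted with multiplicity; * (drifting concept) the training examples $(X_i,Y_i)$, $i\ge 1$, are independent, every $X_i$ has law $\mathbf P_X$, $\Pr(Y_i=j\mid X_i)=\eta^i_j(X_i)$, and $\sup_{x\in\mathbb R^d}|\eta^n_j(x)-\eta_j(x)|=O(n^{-(\beta+d)/(2\beta+d)})$ as $n\to\infty$ for every $j$; * (kernel) $K:\mathbb R^d\to\mathbb R$ is measurable and, for some $c>0$, $K(x)\ge c\,\mathbf 1_{\{\|x\|\le c\}}$ for all $x$; moreover $\int K(u)\,du=1$, $\sup_u(1+\|u\|^{2\beta})K(u)<\infty$, $\int(1+\|u\|^{4\beta})K^2(u)\,du<\infty$, and $\int\|u\|^{\lfloor\beta\rfloor+\beta}K(u)\,du<\infty$.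 For $n\ge 1$ let $h=n^{-1/(2\beta+d)}$. For each class $j$ let $\hat\eta^{\rm LP}_{n,j}(x)=\hat\theta(0)$ if $\hat\theta$ is the unique minimizer of $\sum_{i=1}^n[\mathbf 1_{\{Y_i=j\}}-\theta(X_i-x)]^2K((X_i-x)/h)$ over all polynomials $\theta$ on $\mathbb R^d$ of degree at most $\lfloor\beta\rfloor$, and $\hat\eta^{\rm LP}_{n,j}(x)=0$ if the minimizer is not unique. Let $\hat\eta_{n,j}=\max(0,\min(1,\hat\eta^{\rm LP}_{n,j}))$, and let $\hat f_n(x)\in\arg\max_j\hat\eta_{n,j}(x)$ (ties broken in any measurable way) be the one-vs-all plug-in classifier. Then there is a constant $C>0$ such that for all $n\ge 1$ with $n^{-1/(2\beta+d)}\le r_0/c$, $$\mathbf E R(\hat f_n)-R(f^*)\le C\,n^{-\beta(1+\alpha)/(2\beta+d)},$$ where the expectation is over the training data. -/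

import Mathlib

open MeasureTheory ProbabilityTheory Filter


noncomputable section

/-- Taylor polynomial of degree `l` of `g` at `x`, evaluated at `x'`. -/
def taylorPoly {d : ℕ} (l : ℕ) (g : EuclideanSpace ℝ (Fin d) → ℝ)
    (x x' : EuclideanSpace ℝ (Fin d)) : ℝ :=
  ∑ k ∈ Finset.range (l + 1),
    ((k.factorial : ℝ))⁻¹ * iteratedFDeriv ℝ k g x (fun _ => x' - x)

/-- The Hölder class `Σ(β, L, ℝ^d)`, where `l` is the integer part of `β`. -/
def IsHolderClass {d : ℕ} (β : ℝ) (l : ℕ) (L : ℝ)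
    (g : EuclideanSpace ℝ (Fin d) → ℝ) : Prop :=
  ContDiff ℝ l g ∧
    ∀ x x' : EuclideanSpace ℝ (Fin d), |g x' - taylorPoly l g x x'| ≤ L * ‖x - x'‖ ^ β

/-- `(c₀, r₀)`-regular sets. -/
def IsRegularSet {d : ℕ} (c₀ r₀ : ℝ) (A : Set (EuclideanSpace ℝ (Fin d))) : Prop :=
  ∀ x ∈ A, ∀ r : ℝ, 0 < r → r ≤ r₀ →
    ENNReal.ofReal c₀ * volume (Metric.ball x r) ≤ volume (A ∩ Metric.ball x r)

/-- Strong density assumption on the law `Q` of the observations: `Q` has a Lebesgue density which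
lies in `[μmin, μmax]` on a compact regular set `A ⊆ 𝒞`, and vanishes off `A`. -/
def StrongDensity {d : ℕ} (c₀ r₀ μmin μmax : ℝ) (𝒞 : Set (EuclideanSpace ℝ (Fin d)))
    (Q : Measure (EuclideanSpace ℝ (Fin d))) : Prop :=
  ∃ (A : Set (EuclideanSpace ℝ (Fin d))) (μ : EuclideanSpace ℝ (Fin d) → ℝ),
    IsCompact A ∧ A ⊆ 𝒞 ∧ IsRegularSet c₀ r₀ A ∧ Measurable μ ∧
    Q = volume.withDensity (fun x => ENNReal.ofReal (μ x)) ∧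
    (∀ x ∈ A, μmin ≤ μ x ∧ μ x ≤ μmax) ∧ (∀ x ∉ A, μ x = 0)

/-- The `(k+1)`-st largest entry of `v` (order statistic, counted with multiplicity). -/
def kthLargest {m : ℕ} (v : Fin m → ℝ) (k : Fin m) : ℝ :=
  v (Tuple.sort v (Fin.rev k))

/-- Multiclass margin assumption for the law `Q` of the observations and the conditional label
probabilities `η`: the gap between the two largest `η j x` is rarely small. -/
def MarginAssumption {d m : ℕ} (hm : 2 ≤ m) (C₀ α : ℝ)
    (Q : Measure (EuclideanSpace ℝ (Fin d)))
    (η : Fin m → EuclideanSpace ℝ (Fin d) → ℝ) : Prop :=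
  ∀ t : ℝ, 0 < t →
    Q {x | kthLargest (fun j => η j x) ⟨0, by omega⟩
          - kthLargest (fun j => η j x) ⟨1, by omega⟩ ≤ t} ≤ ENNReal.ofReal (C₀ * t ^ α)

/-- Conditions on the kernel. -/
structure IsAdmissibleKernel {d : ℕ} (β c : ℝ) (K : EuclideanSpace ℝ (Fin d) → ℝ) : Prop where
  measurable : Measurable K
  lower : ∀ x, c * (Metric.closedBall 0 c).indicator (fun _ => (1 : ℝ)) x ≤ K x
  integrable : Integrable K
  integral_eq_one : ∫ u, K u = 1
  bddAbove : BddAbove (Set.range fun u => (1 + ‖u‖ ^ (2 * β)) * K u)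
  integrable_sq : Integrable fun u => (1 + ‖u‖ ^ (4 * β)) * K u ^ 2

/-- The weighted least squares criterion at the point `x` for the polynomial `θ`, for the training
data `z` with binary (one-vs-all) labels `1` if the label is `j`, and `0` otherwise. -/
def lpCriterion {d m n : ℕ} (K : EuclideanSpace ℝ (Fin d) → ℝ) (h : ℝ)
    (z : Fin n → EuclideanSpace ℝ (Fin d) × Fin m) (j : Fin m)
    (x : EuclideanSpace ℝ (Fin d)) (θ : MvPolynomial (Fin d) ℝ) : ℝ :=
  ∑ i, ((if (z i).2 = j then (1 : ℝ) else 0)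
      - MvPolynomial.eval (fun a => ((z i).1 - x) a) θ) ^ 2 * K (h⁻¹ • ((z i).1 - x))

/-- `θ` minimizes the criterion among all polynomials of degree at most `l`. -/
def IsLPMinimizer {d m n : ℕ} (K : EuclideanSpace ℝ (Fin d) → ℝ) (h : ℝ) (l : ℕ)
    (z : Fin n → EuclideanSpace ℝ (Fin d) × Fin m) (j : Fin m)
    (x : EuclideanSpace ℝ (Fin d)) (θ : MvPolynomial (Fin d) ℝ) : Prop :=
  θ.totalDegree ≤ l ∧
    ∀ θ' : MvPolynomial (Fin d) ℝ, θ'.totalDegree ≤ l →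
      lpCriterion K h z j x θ ≤ lpCriterion K h z j x θ'

open Classical in
/-- The local polynomial estimator of order `l` for class `j`, at the point `x`: the value at the
origin of the minimizing polynomial if that is unique, and `0` otherwise. -/
def lpEstimator {d m n : ℕ} (K : EuclideanSpace ℝ (Fin d) → ℝ) (h : ℝ) (l : ℕ)
    (z : Fin n → EuclideanSpace ℝ (Fin d) × Fin m) (j : Fin m)
    (x : EuclideanSpace ℝ (Fin d)) : ℝ :=
  if H : ∃! θ : MvPolynomial (Fin d) ℝ, IsLPMinimizer K h l z j x θ then
    MvPolynomial.eval (fun _ => (0 : ℝ)) H.choose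
  else 0

/-- The local polynomial estimator truncated to `[0, 1]`. -/
def etaHat {d m n : ℕ} (K : EuclideanSpace ℝ (Fin d) → ℝ) (h : ℝ) (l : ℕ)
    (z : Fin n → EuclideanSpace ℝ (Fin d) × Fin m) (j : Fin m)
    (x : EuclideanSpace ℝ (Fin d)) : ℝ :=
  max 0 (min 1 (lpEstimator K h l z j x))

/-- `f` is a one-vs-all plug-in classifier, as a measurable function of the training data and the
observation: it predicts a label which maximizes `etaHat`, ties being broken in any measurable
way. -/
def IsPlugInClassifier {d m n : ℕ} (K : EuclideanSpace ℝ (Fin d) → ℝ) (h : ℝ) (l : ℕ)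
    (f : (Fin n → EuclideanSpace ℝ (Fin d) × Fin m) → EuclideanSpace ℝ (Fin d) → Fin m) :
    Prop :=
  Measurable (Function.uncurry f) ∧
    ∀ z x j, etaHat K h l z j x ≤ etaHat K h l z (f z x) x

/-- `f` is a Bayes classifier: it predicts a label which maximizes `η j x`. -/
def IsBayesClassifier {d m : ℕ} (η : Fin m → EuclideanSpace ℝ (Fin d) → ℝ)
    (f : EuclideanSpace ℝ (Fin d) → Fin m) : Prop :=
  Measurable f ∧ ∀ x j, η j x ≤ η (f x) x

/-- Risk `P(Y ≠ f(X))`. -/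
def risk {d m : ℕ} (P : Measure (EuclideanSpace ℝ (Fin d) × Fin m))
    (f : EuclideanSpace ℝ (Fin d) → Fin m) : ℝ :=
  P.real {z | z.2 ≠ f z.1}

/-- `η j (X)` is a version of the conditional probability of `Y = j` given `X`, for all `j`. -/
def IsLabelProb {d m : ℕ} {Ω : Type*} [MeasurableSpace Ω] (ρ : Measure Ω)
    (X : Ω → EuclideanSpace ℝ (Fin d)) (Y : Ω → Fin m)
    (η : Fin m → EuclideanSpace ℝ (Fin d) → ℝ) : Prop :=
  ∀ j, (fun ω => η j (X ω)) =ᵐ[ρ] ρ⟦Y ⁻¹' {j} | MeasurableSpace.comap X inferInstance⟧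

/-- Training data from a drifting concept: `(X i, Y i)` is the `(i+1)`-st training example, the
examples are independent, all `X i` have the law `Q`, and the label `Y i` has the conditional
probabilities `ηs i j (X i)` given `X i`. -/
structure IsDriftingSample {d m : ℕ} {Ω : Type*} [MeasurableSpace Ω] (ρ : Measure Ω)
    (Q : Measure (EuclideanSpace ℝ (Fin d)))
    (ηs : ℕ → Fin m → EuclideanSpace ℝ (Fin d) → ℝ)
    (X : ℕ → Ω → EuclideanSpace ℝ (Fin d)) (Y : ℕ → Ω → Fin m) : Prop where
  measurable_X : ∀ i, Measurable (X i)
  measurable_Y : ∀ i, Measurable (Y i)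
  indep : iIndepFun (fun i ω => (X i ω, Y i ω)) ρ
  law_X : ∀ i, ρ.map (X i) = Q
  label : ∀ i, IsLabelProb ρ (X i) (Y i) (ηs i)

/-- Uniform convergence of the drifting label probabilities `ηs` to `η`, with
`sup_x |η^n_j(x) - η_j(x)| = O(n ^ (-(β + d) / (2 β + d)))` for all `j` (`ηs i` belongs to the
`(i+1)`-st example). -/
def HasDriftRate {d m : ℕ} (β : ℝ) (ηs : ℕ → Fin m → EuclideanSpace ℝ (Fin d) → ℝ)
    (η : Fin m → EuclideanSpace ℝ (Fin d) → ℝ) : Prop :=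
  ∀ j, ∃ D : ℝ, ∀ᶠ i : ℕ in atTop, ∀ x,
    |ηs i j x - η j x| ≤ D * ((i : ℝ) + 1) ^ (-((β + d) / (2 * β + d)))

/-- Excess risk of the classifier `f` trained from the first `n` examples, relative to `fstar`. -/
def excessRisk {d m n : ℕ} {Ω : Type*} [MeasurableSpace Ω] (ρ : Measure Ω)
    (P : Measure (EuclideanSpace ℝ (Fin d) × Fin m))
    (X : ℕ → Ω → EuclideanSpace ℝ (Fin d)) (Y : ℕ → Ω → Fin m)
    (f : (Fin n → EuclideanSpace ℝ (Fin d) × Fin m) → EuclideanSpace ℝ (Fin d) → Fin m)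
    (fstar : EuclideanSpace ℝ (Fin d) → Fin m) : ℝ :=
  ∫ ω, risk P (f (fun i => (X i ω, Y i ω))) ∂ρ - risk P fstar

end

/-!
The local polynomial estimator at `x` is studied through the rescaled observations
`(X i - x) / h` and the effective sample size `N = n * h ^ d`, which for the bandwidth at hand is
`h ^ (-2 * β)`. Polynomials of degree at most `l` are parametrized by their coefficients `w` in the
rescaled variable (`polyVal`, `scaledPoly`).

*Deterministic part.* The difference between the least squares solution and the rescaled Taylor
polynomial of `η j` solves the normal equations whose right-hand side is the sum of the residuals
of the Taylor polynomial against the monomials. Testing these equations with the difference itself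
shows (`abs_lpEstimator_sub_le`) that the minimizer is unique and that its error is controlled by
the right-hand side, as soon as the weighted design form is at least `N * μ₀ * ∑ s, w s ^ 2`.

*Design.* The kernel is at least `c` on the ball of radius `c`, and the density is at least `μmin`
on the regular set, so the mean of the design form dominates the integral of `polyVal w ^ 2` over
a subset of that ball which fills a fixed proportion of it. A nonzero polynomial vanishes on a null
set only, and compactness of the unit sphere of coefficients turns this into a uniform lower bound
(`exists_integral_polyVal_sq_ge`). Bernstein's inequality (`measure_abs_sum_sub_ge_le`) for the
entries of the truncated design matrix then gives `exists_design_tail`.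

*Residuals.* Conditionally on `X i`, the label indicator has mean `ηs i j (X i)`; hence the mean of
a residual splits into the drift and the Hölder remainder. The remainder contributes `N * h ^ β` by
the moment conditions on the kernel. The drift of the `i`-th example is `O(i ^ (-γ))` with
`γ = (β + d) / (2 * β + d) < 1`, and `∑ i ≤ n, i ^ (-γ) = O(n ^ (1 - γ))`, which is again of the
order `N * h ^ β`. With Bernstein's inequality this gives `exists_lpResidual_tail`. Together, the
estimation error exceeds `h ^ β * t` with probability at most `C * exp (-κ * t ^ 2)`, uniformly in
`x` on the support (`exists_etaHat_tail`).

*Excess risk.* The loss at `x` is at most twice the largest estimation error, and where it is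
positive it is at least the gap between the two largest label probabilities. Cutting it into layers
of width `2 * h ^ β` (`lintegral_loss_le`), the margin assumption bounds the mass of the points with
a small gap, the tail bound the probability of each layer, and the resulting series converges to a
multiple of `h ^ (β * (1 + α))`.
-/

noncomputable section

/-! ### Bernstein's inequality -/

section Bernstein

variable {Ω : Type*} [MeasurableSpace Ω] {ρ : Measure Ω} [IsProbabilityMeasure ρ]

/-- From `exp y ≤ 1 + y + y ^ 2` for `|y| ≤ 1`. -/
theorem mgf_le_exp_of_abs_le {ξ : Ω → ℝ} (hξ : AEStronglyMeasurable ξ ρ) {M t : ℝ}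
    (hM : ∀ᵐ ω ∂ρ, |ξ ω| ≤ M) (ht : 0 ≤ t) (htM : t * M ≤ 1) :
    mgf ξ ρ t ≤ Real.exp (t * ∫ ω, ξ ω ∂ρ + t ^ 2 * ∫ ω, ξ ω ^ 2 ∂ρ) := by
  have hint : Integrable ξ ρ := Integrable.of_bound hξ M (by simpa using hM)
  have hint2 : Integrable (fun ω => ξ ω ^ 2) ρ := by
    refine Integrable.of_bound (hξ.pow 2) (M ^ 2) ?_
    filter_upwards [hM] with ω h
    rw [Real.norm_eq_abs, abs_pow]
    gcongr
  have key : mgf ξ ρ t ≤ ∫ ω, (1 + t * ξ ω + t ^ 2 * ξ ω ^ 2) ∂ρ := by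
    refine integral_mono_of_nonneg (Eventually.of_forall fun ω => (Real.exp_pos _).le) ?_ ?_
    · exact ((integrable_const _).add (hint.const_mul _)).add (hint2.const_mul _)
    · filter_upwards [hM] with ω h
      have h1 : |t * ξ ω| ≤ 1 := by
        rw [abs_mul, abs_of_nonneg ht]
        exact (mul_le_mul_of_nonneg_left h ht).trans htM
      have h2 := (abs_le.1 (Real.abs_exp_sub_one_sub_id_le h1)).2
      rw [mul_pow] at h2
      linarith
  have h3 : ∫ ω, (1 + t * ξ ω + t ^ 2 * ξ ω ^ 2) ∂ρ
      = 1 + (t * ∫ ω, ξ ω ∂ρ + t ^ 2 * ∫ ω, ξ ω ^ 2 ∂ρ) := by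
    have h4 : Integrable (fun ω => 1 + t * ξ ω) ρ := (integrable_const _).add (hint.const_mul _)
    rw [integral_add h4 (hint2.const_mul _),
      integral_add (integrable_const _) (hint.const_mul _), integral_const_mul,
      integral_const_mul]
    simp [add_assoc]
  rw [h3] at key
  linarith [Real.add_one_le_exp (t * ∫ ω, ξ ω ∂ρ + t ^ 2 * ∫ ω, ξ ω ^ 2 ∂ρ)]

/-- The Chernoff bound, with a free parameter `t` at most the inverse of the bound `M`. -/
theorem measure_sum_sub_ge_le {ι : Type*} {ξ : ι → Ω → ℝ} (hξ : ∀ i, Measurable (ξ i))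
    (hind : iIndepFun ξ ρ) (s : Finset ι) {M t a : ℝ} (hM : ∀ i, ∀ᵐ ω ∂ρ, |ξ i ω| ≤ M)
    (ht : 0 ≤ t) (htM : t * M ≤ 1) :
    ρ.real {ω | a ≤ ∑ i ∈ s, ξ i ω - ∑ i ∈ s, ∫ ω, ξ i ω ∂ρ}
      ≤ Real.exp (-t * a + t ^ 2 * ∑ i ∈ s, ∫ ω, ξ i ω ^ 2 ∂ρ) := by
  have hset : {ω | a ≤ ∑ i ∈ s, ξ i ω - ∑ i ∈ s, ∫ ω, ξ i ω ∂ρ}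
      = {ω | a + ∑ i ∈ s, ∫ ω, ξ i ω ∂ρ ≤ (∑ i ∈ s, ξ i) ω} := by
    ext ω
    simp only [Set.mem_ofPred_eq, Finset.sum_apply]
    exact le_sub_iff_add_le
  have hsum : ∀ ω, ∑ i ∈ s, ξ i ω = (∑ i ∈ s, ξ i) ω := fun ω => by simp
  have hbd : ∀ᵐ ω ∂ρ, |(∑ i ∈ s, ξ i) ω| ≤ ∑ _i ∈ s, M := by
    have : ∀ᵐ ω ∂ρ, ∀ i ∈ s, |ξ i ω| ≤ M := (ae_ball_iff s.countable_toSet).2 fun i _ => hM i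
    filter_upwards [this] with ω h
    rw [← hsum]
    exact (Finset.abs_sum_le_sum_abs _ _).trans (Finset.sum_le_sum h)
  have hmeas : Measurable (∑ i ∈ s, ξ i) := by
    convert Finset.measurable_sum s fun i _ => hξ i using 1
    exact (funext hsum).symm
  have hint : Integrable (fun ω => Real.exp (t * (∑ i ∈ s, ξ i) ω)) ρ := by
    refine Integrable.of_bound (by fun_prop) (Real.exp (t * ∑ _i ∈ s, M)) ?_
    filter_upwards [hbd] with ω h
    rw [Real.norm_eq_abs, Real.abs_exp]
    gcongr
    exact (le_abs_self _).trans h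
  rw [hset]
  refine (measure_ge_le_exp_mul_mgf _ ht hint).trans ?_
  rw [hind.mgf_sum hξ]
  have hprod : ∏ i ∈ s, mgf (ξ i) ρ t
      ≤ ∏ i ∈ s, Real.exp (t * ∫ ω, ξ i ω ∂ρ + t ^ 2 * ∫ ω, ξ i ω ^ 2 ∂ρ) :=
    Finset.prod_le_prod (fun i _ => mgf_nonneg) fun i _ =>
      mgf_le_exp_of_abs_le (hξ i).aestronglyMeasurable (hM i) ht htM
  refine (mul_le_mul_of_nonneg_left hprod (Real.exp_pos _).le).trans (le_of_eq ?_)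
  rw [← Real.exp_sum, ← Real.exp_add, Finset.sum_add_distrib, ← Finset.mul_sum,
    ← Finset.mul_sum]
  congr 1
  ring

/-- Bernstein's inequality, for deviations `N * δ` with `δ ≤ 1` at the scale `N` of the total
variance. -/
theorem measure_abs_sum_sub_ge_le {ι : Type*} {ξ : ι → Ω → ℝ} (hξ : ∀ i, Measurable (ξ i))
    (hind : iIndepFun ξ ρ) (s : Finset ι) {M v N δ : ℝ} (hM : ∀ i, ∀ᵐ ω ∂ρ, |ξ i ω| ≤ M)
    (hM0 : 0 < M) (hv0 : 0 < v) (hN : 0 ≤ N) (hδ0 : 0 ≤ δ) (hδ1 : δ ≤ 1)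
    (hv : ∑ i ∈ s, ∫ ω, ξ i ω ^ 2 ∂ρ ≤ v * N) :
    ρ.real {ω | N * δ ≤ |∑ i ∈ s, ξ i ω - ∑ i ∈ s, ∫ ω, ξ i ω ∂ρ|}
      ≤ 2 * Real.exp (-(min M⁻¹ (2 * v)⁻¹ / 2) * (N * δ ^ 2)) := by
  set κ := min M⁻¹ (2 * v)⁻¹ with hκ
  have hκ0 : 0 < κ := lt_min (by positivity) (by positivity)
  have hκM : κ * M ≤ 1 := by
    calc κ * M ≤ M⁻¹ * M := by gcongr; exact min_le_left _ _
      _ = 1 := inv_mul_cancel₀ hM0.ne'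
  have hκv : κ * v ≤ 1 / 2 := by
    calc κ * v ≤ (2 * v)⁻¹ * v := by gcongr; exact min_le_right _ _
      _ = 1 / 2 := by field_simp
  have htM : κ * δ * M ≤ 1 := by nlinarith [mul_pos hκ0 hM0]
  have hexp : -(κ * δ) * (N * δ) + (κ * δ) ^ 2 * (v * N) ≤ -(κ / 2) * (N * δ ^ 2) := by
    have : 0 ≤ κ * (N * δ ^ 2) * (1 / 2 - κ * v) := by
      have := sub_nonneg.2 hκv
      positivity
    nlinarith
  have bound : ∀ ζ : ι → Ω → ℝ, (∀ i, Measurable (ζ i)) → iIndepFun ζ ρ →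
      (∀ i, ∀ᵐ ω ∂ρ, |ζ i ω| ≤ M) → ∑ i ∈ s, ∫ ω, ζ i ω ^ 2 ∂ρ ≤ v * N →
      ρ.real {ω | N * δ ≤ ∑ i ∈ s, ζ i ω - ∑ i ∈ s, ∫ ω, ζ i ω ∂ρ}
        ≤ Real.exp (-(κ / 2) * (N * δ ^ 2)) := by
    intro ζ h1 h2 h3 h4
    refine (measure_sum_sub_ge_le h1 h2 s h3 (by positivity) htM).trans ?_
    gcongr
    refine le_trans ?_ hexp
    gcongr
  have hsub : {ω | N * δ ≤ |∑ i ∈ s, ξ i ω - ∑ i ∈ s, ∫ ω, ξ i ω ∂ρ|}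
      ⊆ {ω | N * δ ≤ ∑ i ∈ s, ξ i ω - ∑ i ∈ s, ∫ ω, ξ i ω ∂ρ}
        ∪ {ω | N * δ ≤ ∑ i ∈ s, -ξ i ω - ∑ i ∈ s, ∫ ω, -ξ i ω ∂ρ} := by
    intro ω hω
    simp only [Set.mem_ofPred_eq, Set.mem_union, integral_neg, Finset.sum_neg_distrib] at hω ⊢
    rcases le_abs.1 hω with h | h
    · exact Or.inl h
    · exact Or.inr (by linarith)
  refine (measureReal_mono hsub).trans ((measureReal_union_le _ _).trans ?_)
  rw [two_mul]
  refine add_le_add (bound ξ hξ hind hM hv) (bound (fun i ω => -ξ i ω) (fun i => (hξ i).neg) ?_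
    (by simpa using hM) (by simpa using hv))
  exact hind.comp (fun _ x => -x) fun _ => measurable_neg

end Bernstein

/-! ### Polynomials of bounded degree on Euclidean space -/

section Polynomials

/-- The exponents of the monomials of degree at most `l` in `d` variables. -/
abbrev MonoIdx (d l : ℕ) : Type := {s : Fin d →₀ ℕ // s.degree ≤ l}

instance (d l : ℕ) : Fintype (MonoIdx d l) := (Finsupp.finite_of_degree_le l).fintype

variable {d l : ℕ}

/-- The monomial function `u ↦ u ^ s` on Euclidean space. -/
def mono (s : Fin d →₀ ℕ) (u : EuclideanSpace ℝ (Fin d)) : ℝ := ∏ a, u a ^ s a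

/-- The polynomial function of degree at most `l` with the coefficients `w`. -/
def polyVal (w : MonoIdx d l → ℝ) (u : EuclideanSpace ℝ (Fin d)) : ℝ := ∑ s, w s * mono s.1 u

/-- The polynomial `y ↦ polyVal w (y / h)`. -/
def scaledPoly (h : ℝ) (w : MonoIdx d l → ℝ) : MvPolynomial (Fin d) ℝ :=
  ∑ s, MvPolynomial.monomial s.1 (w s * h⁻¹ ^ s.1.degree)

theorem continuous_mono (s : Fin d →₀ ℕ) : Continuous (mono s) := by
  unfold mono
  fun_prop

theorem continuous_polyVal (w : MonoIdx d l → ℝ) : Continuous (polyVal w) :=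
  continuous_finsetSum _ fun s _ => continuous_const.mul (continuous_mono s.1)

theorem abs_mono_le (s : Fin d →₀ ℕ) (u : EuclideanSpace ℝ (Fin d)) :
    |mono s u| ≤ ‖u‖ ^ s.degree := by
  rw [mono, Finset.abs_prod, Finsupp.degree_eq_sum, ← Finset.prod_pow_eq_pow_sum]
  refine Finset.prod_le_prod (fun _ _ => abs_nonneg _) fun a _ => ?_
  rw [abs_pow]
  gcongr
  simpa using PiLp.norm_apply_le u a

theorem mono_zero (u : EuclideanSpace ℝ (Fin d)) : mono 0 u = 1 := by simp [mono]

theorem mono_apply_zero (s : Fin d →₀ ℕ) (hs : s ≠ 0) : mono s 0 = 0 := by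
  obtain ⟨a, ha⟩ := Finsupp.ne_iff.1 hs
  exact Finset.prod_eq_zero (Finset.mem_univ a) (by simpa using ha)

theorem polyVal_apply_zero (w : MonoIdx d l → ℝ) : polyVal w 0 = w ⟨0, by simp⟩ := by
  rw [polyVal, Finset.sum_eq_single ⟨0, by simp⟩]
  · simp [mono_zero]
  · intro s _ hs
    rw [mono_apply_zero s.1 (fun h => hs (Subtype.ext h)), mul_zero]
  · simp

theorem polyVal_sub (w w' : MonoIdx d l → ℝ) (u : EuclideanSpace ℝ (Fin d)) :
    polyVal (w - w') u = polyVal w u - polyVal w' u := by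
  simp [polyVal, sub_mul]

theorem eval_scaledPoly (h : ℝ) (w : MonoIdx d l → ℝ) (y : EuclideanSpace ℝ (Fin d)) :
    MvPolynomial.eval (fun a => y a) (scaledPoly h w) = polyVal w (h⁻¹ • y) := by
  rw [scaledPoly, map_sum, polyVal]
  refine Finset.sum_congr rfl fun s _ => ?_
  rw [MvPolynomial.eval_monomial, Finsupp.prod_fintype _ _ (by simp), mono, mul_assoc]
  congr 1
  rw [Finsupp.degree_eq_sum, ← Finset.prod_pow_eq_pow_sum, ← Finset.prod_mul_distrib]
  simp [mul_pow]

theorem totalDegree_scaledPoly_le (h : ℝ) (w : MonoIdx d l → ℝ) :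
    (scaledPoly h w).totalDegree ≤ l := by
  refine MvPolynomial.totalDegree_finsetSum_le fun s _ => ?_
  refine (MvPolynomial.totalDegree_monomial_le _ _).trans ?_
  exact s.2

/-- For `h ≠ 0` the coefficients parametrize all polynomials of degree at most `l`. -/
theorem exists_scaledPoly_eq {h : ℝ} (hh : h ≠ 0) {θ : MvPolynomial (Fin d) ℝ}
    (hθ : θ.totalDegree ≤ l) : ∃ w : MonoIdx d l → ℝ, scaledPoly h w = θ := by
  refine ⟨fun s => θ.coeff s.1 * h ^ s.1.degree, ?_⟩
  ext t
  have hcancel : ∀ s : MonoIdx d l,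
      θ.coeff s.1 * h ^ s.1.degree * h⁻¹ ^ s.1.degree = θ.coeff s.1 := fun s => by
    rw [mul_assoc, ← mul_pow, mul_inv_cancel₀ hh, one_pow, mul_one]
  simp only [scaledPoly, MvPolynomial.coeff_sum, MvPolynomial.coeff_monomial, hcancel]
  by_cases ht : t.degree ≤ l
  · rw [Finset.sum_eq_single ⟨t, ht⟩]
    · simp
    · intro s _ hs
      rw [if_neg fun h => hs (Subtype.ext h)]
    · simp
  · rw [MvPolynomial.coeff_eq_zero_of_totalDegree_lt (f := θ) (d := t)]
    · refine Finset.sum_eq_zero fun s _ => if_neg ?_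
      rintro rfl
      exact ht s.2
    · exact hθ.trans_lt (not_le.1 ht)

/-- The Taylor polynomial is a polynomial, by expansion of the multilinear derivatives in the
standard basis. -/
theorem exists_polynomial_eq_taylorPoly (g : EuclideanSpace ℝ (Fin d) → ℝ)
    (x : EuclideanSpace ℝ (Fin d)) :
    ∃ θ : MvPolynomial (Fin d) ℝ, θ.totalDegree ≤ l ∧
      ∀ x', taylorPoly l g x x' = MvPolynomial.eval (fun a => (x' - x) a) θ := by
  refine ⟨∑ k ∈ Finset.range (l + 1), ∑ r : Fin k → Fin d,
    MvPolynomial.C ((k.factorial : ℝ)⁻¹ *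
      iteratedFDeriv ℝ k g x fun i => EuclideanSpace.basisFun (Fin d) ℝ (r i)) *
      ∏ i, MvPolynomial.X (r i), ?_, fun x' => ?_⟩
  · refine MvPolynomial.totalDegree_finsetSum_le fun k hk => ?_
    refine MvPolynomial.totalDegree_finsetSum_le fun r _ => ?_
    refine (MvPolynomial.totalDegree_mul _ _).trans ?_
    rw [MvPolynomial.totalDegree_C, zero_add]
    refine (MvPolynomial.totalDegree_finsetProd _ _).trans ?_
    simp only [MvPolynomial.totalDegree_X, Finset.sum_const, Finset.card_univ, Fintype.card_fin,
      smul_eq_mul, mul_one]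
    exact Nat.lt_succ_iff.1 (Finset.mem_range.1 hk)
  · rw [taylorPoly, map_sum]
    refine Finset.sum_congr rfl fun k _ => ?_
    have hsum : x' - x = ∑ a, (x' - x) a • EuclideanSpace.basisFun (Fin d) ℝ a := by
      conv_lhs => rw [← (EuclideanSpace.basisFun (Fin d) ℝ).sum_repr (x' - x)]
      simp
    have hmul : iteratedFDeriv ℝ k g x (fun _ => x' - x)
        = ∑ r : Fin k → Fin d, (∏ i, (x' - x) (r i)) *
          iteratedFDeriv ℝ k g x fun i => EuclideanSpace.basisFun (Fin d) ℝ (r i) := by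
      conv_lhs => rw [hsum]
      rw [ContinuousMultilinearMap.map_sum]
      refine Finset.sum_congr rfl fun r _ => ?_
      rw [ContinuousMultilinearMap.map_smul_univ, smul_eq_mul]
    rw [hmul, map_sum, Finset.mul_sum]
    refine Finset.sum_congr rfl fun r _ => ?_
    simp only [map_mul, MvPolynomial.eval_C, map_prod, MvPolynomial.eval_X]
    ring

/-- A nonzero polynomial is nonzero almost everywhere: by induction, for almost all values of the
last variables it is a nonzero polynomial in the first variable, so Fubini's theorem applies. -/
theorem ae_eval_ne_zero {n : ℕ} {p : MvPolynomial (Fin n) ℝ} (hp : p ≠ 0) :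
    ∀ᵐ x : Fin n → ℝ, MvPolynomial.eval x p ≠ 0 := by
  induction n with
  | zero =>
    rw [MvPolynomial.eq_C_of_isEmpty p] at hp ⊢
    refine Eventually.of_forall fun x => ?_
    rw [MvPolynomial.eval_C]
    exact fun h => hp (by rw [h, map_zero])
  | succ n ih =>
    have hq : MvPolynomial.finSuccEquiv ℝ n p ≠ 0 := by simpa using hp
    obtain ⟨i, hi⟩ : ∃ i, (MvPolynomial.finSuccEquiv ℝ n p).coeff i ≠ 0 := by
      by_contra! h
      exact hq (Polynomial.ext fun i => by simpa using h i)
    have hmp := volume_preserving_piFinSuccAbove (fun _ : Fin (n + 1) => ℝ) 0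
    have hmeas : MeasurableSet
        {z : ℝ × (Fin n → ℝ) | MvPolynomial.eval (Fin.cons z.1 z.2 : Fin (n + 1) → ℝ) p = 0} := by
      refine (isClosed_eq ?_ continuous_const).measurableSet
      refine (MvPolynomial.continuous_eval p).comp ?_
      refine continuous_pi fun j => ?_
      refine Fin.cases ?_ (fun k => ?_) j
      · simpa using continuous_fst
      · simpa using (by fun_prop : Continuous fun a : ℝ × (Fin n → ℝ) => a.2 k)
    have hnull : (volume : Measure (ℝ × (Fin n → ℝ)))
        {z | MvPolynomial.eval (Fin.cons z.1 z.2 : Fin (n + 1) → ℝ) p = 0} = 0 := by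
      rw [Measure.volume_eq_prod, Measure.prod_apply_symm hmeas]
      refine (lintegral_congr_ae (g := fun _ => 0) ?_).trans (by simp)
      filter_upwards [ih hi] with y hy
      have hr : Polynomial.map (MvPolynomial.eval y) (MvPolynomial.finSuccEquiv ℝ n p) ≠ 0 :=
        fun h => hy (by simpa using congrArg (fun q => Polynomial.coeff q i) h)
      refine measure_mono_null (t :=
        ((Polynomial.map (MvPolynomial.eval y)
          (MvPolynomial.finSuccEquiv ℝ n p)).roots.toFinset : Set ℝ)) ?_
        (Finset.measure_zero _ _)
      intro a ha
      simp only [Set.mem_preimage, Set.mem_ofPred_eq] at ha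
      rw [MvPolynomial.eval_eq_eval_mv_eval'] at ha
      simpa [hr] using ha
    rw [← hmp.measure_preimage hmeas.nullMeasurableSet] at hnull
    rw [ae_iff]
    convert hnull using 2
    ext x
    simp only [ne_eq, not_not, Set.mem_ofPred_eq, Set.mem_preimage]
    rw [show (Fin.cons ((MeasurableEquiv.piFinSuccAbove (fun _ : Fin (n + 1) => ℝ) 0) x).1
      ((MeasurableEquiv.piFinSuccAbove (fun _ : Fin (n + 1) => ℝ) 0) x).2 : Fin (n + 1) → ℝ) = x
      from ?_]
    exact Fin.cons_self_tail x

theorem ae_polyVal_ne_zero {w : MonoIdx d l → ℝ} (hw : w ≠ 0) : ∀ᵐ u, polyVal w u ≠ 0 := by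
  have hp : scaledPoly 1 w ≠ 0 := by
    intro h0
    obtain ⟨s, hs⟩ := Function.ne_iff.1 hw
    apply hs
    have := congrArg (MvPolynomial.coeff s.1) h0
    simp only [scaledPoly, MvPolynomial.coeff_sum, MvPolynomial.coeff_monomial] at this
    rw [Finset.sum_eq_single s] at this
    · simpa using this
    · intro t _ hts
      rw [if_neg fun h => hts (Subtype.ext h)]
    · simp
  have h := (EuclideanSpace.volume_preserving_symm_measurableEquiv_toLp
    (Fin d)).quasiMeasurePreserving.ae (ae_eval_ne_zero hp)
  filter_upwards [h] with u hu
  have h2 := eval_scaledPoly 1 w u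
  rw [inv_one, one_smul] at h2
  rw [← h2]
  exact hu

end Polynomials

/-! ### A uniform lower bound for integrals of squared polynomials -/

section LowerBound

variable {d l : ℕ}

/-- Continuity of the measure from above, since the zero set is null. The factor `2` leaves room
for a perturbation of the coefficients. -/
theorem exists_measureReal_abs_polyVal_le {w : MonoIdx d l → ℝ} (hw : w ≠ 0) (c : ℝ) {ε : ℝ}
    (hε : 0 < ε) :
    ∃ t : ℝ, 0 < t ∧ volume.real {u ∈ Metric.ball 0 c | |polyVal w u| ≤ 2 * t} ≤ ε := by
  set F : ℕ → Set (EuclideanSpace ℝ (Fin d)) :=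
    fun k => {u ∈ Metric.ball 0 c | |polyVal w u| ≤ 2 * (1 / ((k : ℝ) + 1))} with hF
  have hmeas : ∀ k, MeasurableSet (F k) := fun k =>
    Metric.isOpen_ball.measurableSet.inter
      (measurableSet_le (continuous_polyVal w).abs.measurable measurable_const)
  have hanti : Antitone F := by
    intro k k' hkk u hu
    refine ⟨hu.1, hu.2.trans ?_⟩
    have := Nat.one_div_le_one_div (α := ℝ) hkk
    linarith
  have hfin : ∀ k, volume (F k) ≠ ⊤ := fun k =>
    measure_ne_top_of_subset (Set.inter_subset_left) measure_ball_lt_top.ne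
  have hlim := tendsto_measure_iInter_atTop (μ := volume) (fun k => (hmeas k).nullMeasurableSet)
    hanti ⟨0, hfin 0⟩
  have hnull : volume (⋂ k, F k) = 0 := by
    refine measure_mono_null ?_ (ae_iff.1 (ae_polyVal_ne_zero hw))
    intro u hu
    simp only [Set.mem_iInter] at hu
    simp only [ne_eq, not_not, Set.mem_ofPred_eq]
    refine abs_nonpos_iff.1 (ge_of_tendsto' (x := atTop)
      (f := fun k : ℕ => 2 * (1 / ((k : ℝ) + 1))) ?_ fun k => (hu k).2)
    simpa using tendsto_one_div_add_atTop_nhds_zero_nat (𝕜 := ℝ) |>.const_mul 2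
  rw [hnull] at hlim
  obtain ⟨k, hk⟩ := (hlim.eventually (gt_mem_nhds (ENNReal.ofReal_pos.2 hε))).exists
  refine ⟨1 / ((k : ℝ) + 1), by positivity, ?_⟩
  exact ENNReal.toReal_le_of_le_ofReal hε.le hk.le

/-- By compactness of the unit sphere of coefficients, small values of normalized polynomials
are uniformly rare. -/
theorem exists_forall_measureReal_abs_polyVal_le (c : ℝ) {ε : ℝ} (hε : 0 < ε) :
    ∃ t : ℝ, 0 < t ∧ ∀ w : MonoIdx d l → ℝ, ∑ s, w s ^ 2 = 1 →
      volume.real {u ∈ Metric.ball 0 c | |polyVal w u| ≤ t} ≤ ε := by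
  have hcompact : IsCompact {w : MonoIdx d l → ℝ | ∑ s, w s ^ 2 = 1} := by
    refine Metric.isCompact_of_isClosed_isBounded (isClosed_eq (by fun_prop) continuous_const) ?_
    refine (Metric.isBounded_closedBall (x := 0) (r := 1)).subset fun w hw => ?_
    rw [mem_closedBall_zero_iff, pi_norm_le_iff_of_nonneg zero_le_one]
    intro s
    rw [Real.norm_eq_abs, ← sq_le_one_iff_abs_le_one]
    have hw' : ∑ s, w s ^ 2 = 1 := hw
    rw [← hw']
    exact Finset.single_le_sum (f := fun s => w s ^ 2) (fun _ _ => sq_nonneg _)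
      (Finset.mem_univ s)
  have hmono : ∀ (w : MonoIdx d l → ℝ) {t t' : ℝ}, t ≤ t' →
      volume.real {u ∈ Metric.ball 0 c | |polyVal w u| ≤ t}
        ≤ volume.real {u ∈ Metric.ball 0 c | |polyVal w u| ≤ t'} := fun w t t' h =>
    measureReal_mono (fun u hu => ⟨hu.1, hu.2.trans h⟩)
      (measure_ne_top_of_subset Set.inter_subset_left measure_ball_lt_top.ne)
  refine hcompact.induction_on (p := fun T => ∃ t : ℝ, 0 < t ∧ ∀ w ∈ T,
    volume.real {u ∈ Metric.ball 0 c | |polyVal w u| ≤ t} ≤ ε) ?_ ?_ ?_ ?_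
  · exact ⟨1, one_pos, fun w hw => hw.elim⟩
  · rintro T T' hTT ⟨t, ht, h⟩
    exact ⟨t, ht, fun w hw => h w (hTT hw)⟩
  · rintro T T' ⟨t, ht, h⟩ ⟨t', ht', h'⟩
    refine ⟨min t t', lt_min ht ht', ?_⟩
    rintro w (hw | hw)
    · exact (hmono w (min_le_left _ _)).trans (h w hw)
    · exact (hmono w (min_le_right _ _)).trans (h' w hw)
  · intro w hw
    have hw0 : w ≠ 0 := by
      rintro rfl
      have : ∑ s : MonoIdx d l, (0 : MonoIdx d l → ℝ) s ^ 2 = 1 := hw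
      simp at this
    obtain ⟨t, ht, hle⟩ := exists_measureReal_abs_polyVal_le hw0 c hε
    set B : ℝ := ∑ s : MonoIdx d l, |c| ^ s.1.degree with hB
    have hB0 : 0 ≤ B := Finset.sum_nonneg fun s _ => by positivity
    have hnhds : {w' : MonoIdx d l → ℝ | dist w' w * B < t} ∈ nhds w := by
      refine (isOpen_lt (by fun_prop) continuous_const).mem_nhds ?_
      simpa using ht
    refine ⟨_, mem_nhdsWithin_of_mem_nhds hnhds, t, ht, fun w' hw' => le_trans ?_ hle⟩
    refine measureReal_mono (fun u hu => ⟨hu.1, ?_⟩)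
      (measure_ne_top_of_subset Set.inter_subset_left measure_ball_lt_top.ne)
    have hu : ‖u‖ ≤ |c| := (mem_ball_zero_iff.1 hu.1).le.trans (le_abs_self c)
    have hdiff : |polyVal w u - polyVal w' u| ≤ dist w' w * B := by
      rw [← polyVal_sub, polyVal, hB, Finset.mul_sum]
      refine (Finset.abs_sum_le_sum_abs _ _).trans (Finset.sum_le_sum fun s _ => ?_)
      rw [abs_mul]
      refine mul_le_mul ?_ ((abs_mono_le s.1 u).trans (by gcongr)) (abs_nonneg _) dist_nonneg
      rw [dist_comm]
      exact dist_le_pi_dist w w' s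
    have h1 : dist w' w * B < t := hw'
    have h2 : |polyVal w' u| ≤ t := (show u ∈ _ ∧ _ from ‹_›).2
    have h3 := abs_sub_abs_le_abs_sub (polyVal w u) (polyVal w' u)
    linarith

/-- A quadratic lower bound for polynomials, uniform over the subsets of the ball that fill a
fixed proportion of it. -/
theorem exists_integral_polyVal_sq_ge {c c₀ : ℝ} (hc : 0 < c) (hc₀ : 0 < c₀) (d l : ℕ) :
    ∃ κ : ℝ, 0 < κ ∧ ∀ S : Set (EuclideanSpace ℝ (Fin d)), MeasurableSet S →
      S ⊆ Metric.ball 0 c → c₀ * volume.real (Metric.ball (0 : EuclideanSpace ℝ (Fin d)) c)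
        ≤ volume.real S →
      ∀ w : MonoIdx d l → ℝ, κ * ∑ s, w s ^ 2 ≤ ∫ u in S, polyVal w u ^ 2 := by
  set V := volume.real (Metric.ball (0 : EuclideanSpace ℝ (Fin d)) c) with hV
  have hV0 : 0 < V := ENNReal.toReal_pos (Metric.measure_ball_pos _ _ hc).ne'
    measure_ball_lt_top.ne
  obtain ⟨t, ht, hsmall⟩ := exists_forall_measureReal_abs_polyVal_le (d := d) (l := l) c
    (ε := c₀ / 2 * V) (by positivity)
  refine ⟨t ^ 2 * (c₀ / 2 * V), by positivity, fun S hS hSb hSv w => ?_⟩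
  have hSfin : volume S ≠ ⊤ := measure_ne_top_of_subset hSb measure_ball_lt_top.ne
  have hint : ∀ v : MonoIdx d l → ℝ, IntegrableOn (fun u => polyVal v u ^ 2) S := fun v =>
    (((continuous_polyVal v).pow 2).continuousOn.integrableOn_compact
      (isCompact_closedBall 0 c)).mono_set (hSb.trans Metric.ball_subset_closedBall)
  have hunit : ∀ v : MonoIdx d l → ℝ, ∑ s, v s ^ 2 = 1 →
      t ^ 2 * (c₀ / 2 * V) ≤ ∫ u in S, polyVal v u ^ 2 := by
    intro v hv
    set T : Set (EuclideanSpace ℝ (Fin d)) := {u ∈ Metric.ball 0 c | |polyVal v u| ≤ t} with hT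
    have hTm : MeasurableSet T := Metric.isOpen_ball.measurableSet.inter
      (measurableSet_le (continuous_polyVal v).abs.measurable measurable_const)
    have hdiff : c₀ / 2 * V ≤ volume.real (S \ T) := by
      have h1 := le_measureReal_sdiff (μ := volume) (s₁ := S) (s₂ := T)
        (measure_ne_top_of_subset Set.inter_subset_left measure_ball_lt_top.ne)
      have h2 := hsmall v hv
      linarith
    calc t ^ 2 * (c₀ / 2 * V) ≤ t ^ 2 * volume.real (S \ T) := by gcongr
      _ ≤ ∫ u in S \ T, polyVal v u ^ 2 := by
        refine setIntegral_ge_of_const_le_real (hS.diff hTm)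
          (measure_ne_top_of_subset Set.sdiff_subset hSfin) (fun u hu => ?_)
          ((hint v).mono_set Set.sdiff_subset)
        have : t < |polyVal v u| := by
          by_contra h
          exact hu.2 ⟨hSb hu.1, not_lt.1 h⟩
        rw [← sq_abs (polyVal v u)]
        gcongr
      _ ≤ ∫ u in S, polyVal v u ^ 2 :=
        setIntegral_mono_set (hint v) (Eventually.of_forall fun u => sq_nonneg _)
          (LE.le.eventuallyLE Set.sdiff_subset)
  set q := ∑ s, w s ^ 2 with hq
  have hq0 : 0 ≤ q := Finset.sum_nonneg fun s _ => sq_nonneg _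
  rcases hq0.eq_or_lt with h0 | hpos
  · rw [← h0, mul_zero]
    exact integral_nonneg fun u => sq_nonneg _
  · have h1 := hunit ((√q)⁻¹ • w) (by
      simp only [Pi.smul_apply, smul_eq_mul, mul_pow, ← Finset.mul_sum, inv_pow,
        Real.sq_sqrt hq0]
      exact inv_mul_cancel₀ hpos.ne')
    have h2 : ∀ u, polyVal ((√q)⁻¹ • w) u ^ 2 = q⁻¹ * polyVal w u ^ 2 := by
      intro u
      have : polyVal ((√q)⁻¹ • w) u = (√q)⁻¹ * polyVal w u := by
        simp [polyVal, Finset.mul_sum, mul_assoc]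
      rw [this, mul_pow, inv_pow, Real.sq_sqrt hq0]
    simp only [h2, integral_const_mul] at h1
    rw [← div_eq_inv_mul, le_div_iff₀ hpos] at h1
    exact h1

end LowerBound

/-! ### Weighted least squares and the normal equations -/

section Deterministic

variable {d l m n : ℕ}

/-- Testing the moments against monomials with a coefficient vector. -/
theorem sum_mul_sum_mono_eq {ι : Type*} [Fintype ι] (u : ι → EuclideanSpace ℝ (Fin d))
    (k r : ι → ℝ) (v : MonoIdx d l → ℝ) :
    ∑ s, v s * ∑ i, r i * mono s.1 (u i) * k i = ∑ i, r i * polyVal v (u i) * k i := by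
  simp only [polyVal, Finset.mul_sum, Finset.sum_mul]
  rw [Finset.sum_comm]
  refine Finset.sum_congr rfl fun i _ => Finset.sum_congr rfl fun s _ => ?_
  ring

/-- For a nondegenerate design the normal equations are solvable, an injective endomorphism of a
finite-dimensional space being surjective. -/
theorem exists_normal_equations {ι : Type*} [Fintype ι] (u : ι → EuclideanSpace ℝ (Fin d))
    (k Z : ι → ℝ)
    (hpos : ∀ w : MonoIdx d l → ℝ, w ≠ 0 → 0 < ∑ i, polyVal w (u i) ^ 2 * k i) :
    ∃ w : MonoIdx d l → ℝ, ∀ s : MonoIdx d l,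
      ∑ i, (Z i - polyVal w (u i)) * mono s.1 (u i) * k i = 0 := by
  let T : (MonoIdx d l → ℝ) →ₗ[ℝ] (MonoIdx d l → ℝ) :=
    { toFun := fun w s => ∑ i, polyVal w (u i) * mono s.1 (u i) * k i
      map_add' := fun w w' => by
        funext s
        simp [polyVal, add_mul, Finset.sum_add_distrib]
      map_smul' := fun a w => by
        funext s
        simp only [polyVal, Pi.smul_apply, smul_eq_mul, RingHom.id_apply, Finset.mul_sum,
          Finset.sum_mul, mul_assoc] }
  have hT : ∀ w s, T w s = ∑ i, polyVal w (u i) * mono s.1 (u i) * k i := fun _ _ => rfl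
  have hinj : Function.Injective T := by
    refine (injective_iff_map_eq_zero T).2 fun w hw => ?_
    by_contra hne
    refine (hpos w hne).ne' ?_
    have h := sum_mul_sum_mono_eq u k (fun i => polyVal w (u i)) w
    simp only [← hT, hw, Pi.zero_apply, mul_zero, Finset.sum_const_zero] at h
    simpa only [pow_two] using h.symm
  obtain ⟨w, hw⟩ := LinearMap.injective_iff_surjective.1 hinj
    (fun s => ∑ i, Z i * mono s.1 (u i) * k i)
  refine ⟨w, fun s => ?_⟩
  have := congrFun hw s
  rw [hT] at this
  simp only [sub_mul, Finset.sum_sub_distrib, this, sub_self]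

theorem lpCriterion_scaledPoly (K : EuclideanSpace ℝ (Fin d) → ℝ) (h : ℝ)
    (z : Fin n → EuclideanSpace ℝ (Fin d) × Fin m) (j : Fin m) (x : EuclideanSpace ℝ (Fin d))
    (w : MonoIdx d l → ℝ) :
    lpCriterion K h z j x (scaledPoly h w) =
      ∑ i, ((if (z i).2 = j then (1 : ℝ) else 0) - polyVal w (h⁻¹ • ((z i).1 - x))) ^ 2
        * K (h⁻¹ • ((z i).1 - x)) := by
  simp only [lpCriterion, eval_scaledPoly]

/-- For a nondegenerate design a solution of the normal equations is the unique minimizer, since the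
criterion exceeds its value there by the design form of the difference. -/
theorem lpEstimator_eq_of_normal_equations {K : EuclideanSpace ℝ (Fin d) → ℝ} {h : ℝ}
    (hh : h ≠ 0) {z : Fin n → EuclideanSpace ℝ (Fin d) × Fin m} {j : Fin m}
    {x : EuclideanSpace ℝ (Fin d)}
    (hpos : ∀ w : MonoIdx d l → ℝ, w ≠ 0 →
      0 < ∑ i, polyVal w (h⁻¹ • ((z i).1 - x)) ^ 2 * K (h⁻¹ • ((z i).1 - x)))
    {w : MonoIdx d l → ℝ}
    (hw : ∀ s : MonoIdx d l, ∑ i, ((if (z i).2 = j then (1 : ℝ) else 0)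
      - polyVal w (h⁻¹ • ((z i).1 - x))) * mono s.1 (h⁻¹ • ((z i).1 - x))
        * K (h⁻¹ • ((z i).1 - x)) = 0) :
    lpEstimator K h l z j x = polyVal w 0 := by
  have hcrit : ∀ v : MonoIdx d l → ℝ, lpCriterion K h z j x (scaledPoly h v)
      = lpCriterion K h z j x (scaledPoly h w)
        + ∑ i, polyVal (v - w) (h⁻¹ • ((z i).1 - x)) ^ 2 * K (h⁻¹ • ((z i).1 - x)) := by
    intro v
    have h0 := sum_mul_sum_mono_eq (fun i => h⁻¹ • ((z i).1 - x))
      (fun i => K (h⁻¹ • ((z i).1 - x)))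
      (fun i => (if (z i).2 = j then (1 : ℝ) else 0) - polyVal w (h⁻¹ • ((z i).1 - x))) (v - w)
    simp only [hw, mul_zero, Finset.sum_const_zero] at h0
    have h1 : lpCriterion K h z j x (scaledPoly h v)
        = lpCriterion K h z j x (scaledPoly h w)
          + ∑ i, polyVal (v - w) (h⁻¹ • ((z i).1 - x)) ^ 2 * K (h⁻¹ • ((z i).1 - x))
          - 2 * ∑ i, ((if (z i).2 = j then (1 : ℝ) else 0) - polyVal w (h⁻¹ • ((z i).1 - x)))
            * polyVal (v - w) (h⁻¹ • ((z i).1 - x)) * K (h⁻¹ • ((z i).1 - x)) := by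
      rw [lpCriterion_scaledPoly, lpCriterion_scaledPoly, ← Finset.sum_add_distrib,
        Finset.mul_sum, ← Finset.sum_sub_distrib]
      refine Finset.sum_congr rfl fun i _ => ?_
      rw [polyVal_sub]
      ring
    rw [h1, ← h0, mul_zero, sub_zero]
  have hmin : IsLPMinimizer K h l z j x (scaledPoly h w) := by
    refine ⟨totalDegree_scaledPoly_le h w, fun θ hθ => ?_⟩
    obtain ⟨v, rfl⟩ := exists_scaledPoly_eq hh hθ
    rw [hcrit v]
    rcases eq_or_ne (v - w) 0 with h0 | h0
    · rw [h0]
      simp [polyVal]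
    · exact le_add_of_nonneg_right (hpos _ h0).le
  have huniq : ∀ θ, IsLPMinimizer K h l z j x θ → θ = scaledPoly h w := by
    intro θ hθ
    obtain ⟨v, rfl⟩ := exists_scaledPoly_eq hh hθ.1
    have h1 := hθ.2 _ (totalDegree_scaledPoly_le h w)
    rw [hcrit v] at h1
    by_cases h0 : v - w = 0
    · rw [sub_eq_zero.1 h0]
    · linarith [hpos _ h0]
  have H : ∃! θ : MvPolynomial (Fin d) ℝ, IsLPMinimizer K h l z j x θ := ⟨_, hmin, huniq⟩
  rw [lpEstimator, dif_pos H, huniq _ H.choose_spec.1]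
  simpa using eval_scaledPoly h w 0

/-- Deterministic error bound: if the design is nondegenerate and the weighted moments of the
residuals of a reference polynomial are small, then the local polynomial estimator is close to
the value of the reference polynomial at the origin. -/
theorem abs_lpEstimator_sub_le {K : EuclideanSpace ℝ (Fin d) → ℝ} {h : ℝ}
    (hh : h ≠ 0) {z : Fin n → EuclideanSpace ℝ (Fin d) × Fin m} {j : Fin m}
    {x : EuclideanSpace ℝ (Fin d)} {N μ₀ δ : ℝ} (hN : 0 < N) (hμ₀ : 0 < μ₀)
    (hdesign : ∀ w : MonoIdx d l → ℝ, N * μ₀ * ∑ s, w s ^ 2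
      ≤ ∑ i, polyVal w (h⁻¹ • ((z i).1 - x)) ^ 2 * K (h⁻¹ • ((z i).1 - x)))
    (w₀ : MonoIdx d l → ℝ)
    (hres : ∀ s : MonoIdx d l, |∑ i, ((if (z i).2 = j then (1 : ℝ) else 0)
      - polyVal w₀ (h⁻¹ • ((z i).1 - x))) * mono s.1 (h⁻¹ • ((z i).1 - x))
        * K (h⁻¹ • ((z i).1 - x))| ≤ N * δ) :
    |lpEstimator K h l z j x - polyVal w₀ 0| ≤ Fintype.card (MonoIdx d l) * δ / μ₀ := by
  have hpos : ∀ w : MonoIdx d l → ℝ, w ≠ 0 →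
      0 < ∑ i, polyVal w (h⁻¹ • ((z i).1 - x)) ^ 2 * K (h⁻¹ • ((z i).1 - x)) := by
    intro w hw
    refine lt_of_lt_of_le ?_ (hdesign w)
    obtain ⟨s, hs⟩ := Function.ne_iff.1 hw
    have : 0 < ∑ s, w s ^ 2 := Finset.sum_pos' (fun _ _ => sq_nonneg _)
      ⟨s, Finset.mem_univ s, by have : w s ≠ 0 := hs; positivity⟩
    positivity
  obtain ⟨w, hw⟩ := exists_normal_equations (fun i => h⁻¹ • ((z i).1 - x))
      (fun i => K (h⁻¹ • ((z i).1 - x))) (fun i => if (z i).2 = j then (1 : ℝ) else 0) hpos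
  rw [lpEstimator_eq_of_normal_equations hh hpos hw, ← polyVal_sub, polyVal_apply_zero]
  set v := w - w₀ with hv
  set T := ∑ s, |v s| with hT
  have hT0 : 0 ≤ T := Finset.sum_nonneg fun _ _ => abs_nonneg _
  have hδ : 0 ≤ δ := by
    have := (abs_nonneg _).trans (hres ⟨0, by simp⟩)
    exact nonneg_of_mul_nonneg_right this hN
  have h1 : ∑ i, polyVal v (h⁻¹ • ((z i).1 - x)) ^ 2 * K (h⁻¹ • ((z i).1 - x))
      ≤ N * δ * T := by
    have e0 := sum_mul_sum_mono_eq (fun i => h⁻¹ • ((z i).1 - x))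
      (fun i => K (h⁻¹ • ((z i).1 - x)))
      (fun i => (if (z i).2 = j then (1 : ℝ) else 0) - polyVal w (h⁻¹ • ((z i).1 - x))) v
    have e1 := sum_mul_sum_mono_eq (fun i => h⁻¹ • ((z i).1 - x))
      (fun i => K (h⁻¹ • ((z i).1 - x)))
      (fun i => (if (z i).2 = j then (1 : ℝ) else 0) - polyVal w₀ (h⁻¹ • ((z i).1 - x))) v
    simp only [hw, mul_zero, Finset.sum_const_zero] at e0
    have e2 : ∑ i, polyVal v (h⁻¹ • ((z i).1 - x)) ^ 2 * K (h⁻¹ • ((z i).1 - x))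
        = ∑ s, v s * ∑ i, ((if (z i).2 = j then (1 : ℝ) else 0)
          - polyVal w₀ (h⁻¹ • ((z i).1 - x))) * mono s.1 (h⁻¹ • ((z i).1 - x))
            * K (h⁻¹ • ((z i).1 - x)) := by
      have e3 : ∑ i, polyVal v (h⁻¹ • ((z i).1 - x)) ^ 2 * K (h⁻¹ • ((z i).1 - x))
          = ∑ i, ((if (z i).2 = j then (1 : ℝ) else 0) - polyVal w₀ (h⁻¹ • ((z i).1 - x)))
              * polyVal v (h⁻¹ • ((z i).1 - x)) * K (h⁻¹ • ((z i).1 - x))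
            - ∑ i, ((if (z i).2 = j then (1 : ℝ) else 0) - polyVal w (h⁻¹ • ((z i).1 - x)))
              * polyVal v (h⁻¹ • ((z i).1 - x)) * K (h⁻¹ • ((z i).1 - x)) := by
        rw [← Finset.sum_sub_distrib]
        refine Finset.sum_congr rfl fun i _ => ?_
        rw [hv, polyVal_sub]
        ring
      rw [e3, ← e0, sub_zero, e1]
    rw [e2, hT, Finset.mul_sum]
    refine Finset.sum_le_sum fun s _ => ?_
    refine (le_abs_self _).trans ?_
    rw [abs_mul, mul_comm]
    gcongr
    exact hres s
  have h2 : T ^ 2 ≤ Fintype.card (MonoIdx d l) * ∑ s, v s ^ 2 := by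
    have := sq_sum_le_card_mul_sum_sq (s := Finset.univ) (f := fun s => |v s|)
    simpa [sq_abs] using this
  have h3 : μ₀ * ∑ s, v s ^ 2 ≤ δ * T := by
    have := (hdesign v).trans h1
    rw [mul_assoc, mul_assoc] at this
    exact le_of_mul_le_mul_left this hN
  have h4 : |v ⟨0, by simp⟩| ≤ T :=
    Finset.single_le_sum (f := fun s => |v s|) (fun _ _ => abs_nonneg _) (Finset.mem_univ _)
  refine h4.trans ?_
  rw [le_div_iff₀ hμ₀]
  rcases hT0.eq_or_lt with h0 | hTpos
  · rw [← h0, zero_mul]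
    positivity
  · refine le_of_mul_le_mul_right ?_ hTpos
    calc T * μ₀ * T = μ₀ * T ^ 2 := by ring
      _ ≤ μ₀ * (Fintype.card (MonoIdx d l) * ∑ s, v s ^ 2) := by gcongr
      _ = Fintype.card (MonoIdx d l) * (μ₀ * ∑ s, v s ^ 2) := by ring
      _ ≤ Fintype.card (MonoIdx d l) * (δ * T) := by gcongr
      _ = Fintype.card (MonoIdx d l) * δ * T := by ring

end Deterministic

/-! ### Conditional label probabilities -/

section LabelProbabilities

variable {d m : ℕ} {Ω : Type*} [MeasurableSpace Ω] {ρ : Measure Ω} [IsProbabilityMeasure ρ]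
  {X : Ω → EuclideanSpace ℝ (Fin d)} {Y : Ω → Fin m}

theorem condProb_mem_Icc (hY : Measurable Y) (j : Fin m) :
    ∀ᵐ ω ∂ρ, (ρ⟦Y ⁻¹' {j} | MeasurableSpace.comap X inferInstance⟧) ω ∈ Set.Icc (0 : ℝ) 1 := by
  by_cases hm : MeasurableSpace.comap X inferInstance ≤ ‹MeasurableSpace Ω›
  · have hj : MeasurableSet (Y ⁻¹' {j}) := hY (measurableSet_singleton j)
    have h0 := condExp_nonneg (μ := ρ) (m := MeasurableSpace.comap X inferInstance)
      (f := (Y ⁻¹' {j}).indicator fun _ => (1 : ℝ))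
      (Eventually.of_forall fun ω => Set.indicator_nonneg (fun _ _ => zero_le_one) ω)
    have h1 := condExp_mono (μ := ρ) (m := MeasurableSpace.comap X inferInstance)
      (f := (Y ⁻¹' {j}).indicator fun _ => (1 : ℝ)) (g := fun _ => (1 : ℝ))
      ((integrable_const _).indicator hj) (integrable_const _)
      (Eventually.of_forall fun ω => Set.indicator_le_self' (fun _ _ => zero_le_one) ω)
    rw [condExp_const hm] at h1
    filter_upwards [h0, h1] with ω a b
    exact ⟨a, b⟩
  · rw [condExp_of_not_le hm]
    simp

theorem IsLabelProb.ae_mem_Icc {η : Fin m → EuclideanSpace ℝ (Fin d) → ℝ} (hY : Measurable Y)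
    (hη : IsLabelProb ρ X Y η) (j : Fin m) : ∀ᵐ ω ∂ρ, η j (X ω) ∈ Set.Icc (0 : ℝ) 1 := by
  filter_upwards [hη j, condProb_mem_Icc (X := X) hY j] with ω h1 h2
  rw [h1]
  exact h2

theorem measurable_labelIndicator (hY : Measurable Y) (j : Fin m) :
    Measurable fun ω => if Y ω = j then (1 : ℝ) else 0 :=
  Measurable.ite (hY (measurableSet_singleton j)) measurable_const measurable_const

/-- Conditioning on the observation replaces the label indicator by the label probability. -/
theorem integral_labelIndicator_mul_eq (hX : Measurable X) (hY : Measurable Y) (j : Fin m)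
    {φ : EuclideanSpace ℝ (Fin d) → ℝ} (hφ : Measurable φ) {M : ℝ} (hM : ∀ x, |φ x| ≤ M) :
    ∫ ω, (if Y ω = j then (1 : ℝ) else 0) * φ (X ω) ∂ρ
      = ∫ ω, (ρ⟦Y ⁻¹' {j} | MeasurableSpace.comap X inferInstance⟧) ω * φ (X ω) ∂ρ := by
  have hj : MeasurableSet (Y ⁻¹' {j}) := hY (measurableSet_singleton j)
  have hint : Integrable ((Y ⁻¹' {j}).indicator fun _ => (1 : ℝ)) ρ :=
    (integrable_const _).indicator hj
  have hφX : StronglyMeasurable[MeasurableSpace.comap X inferInstance] fun ω => φ (X ω) :=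
    (hφ.comp (comap_measurable X)).stronglyMeasurable
  have hprod : Integrable (((Y ⁻¹' {j}).indicator fun _ => (1 : ℝ)) * fun ω => φ (X ω)) ρ :=
    hint.mul_bdd (c := M) (hφ.comp hX).aestronglyMeasurable
      (Eventually.of_forall fun ω => by simpa using hM (X ω))
  have h := condExp_mul_of_aestronglyMeasurable_right (μ := ρ)
    (m := MeasurableSpace.comap X inferInstance) hφX.aestronglyMeasurable hprod hint
  have h2 := integral_congr_ae h
  rw [integral_condExp hX.comap_le] at h2
  rw [show (fun ω => (if Y ω = j then (1 : ℝ) else 0) * φ (X ω))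
    = ((Y ⁻¹' {j}).indicator fun _ => (1 : ℝ)) * fun ω => φ (X ω) from ?_, h2]
  · rfl
  · funext ω
    by_cases hω : Y ω = j
    · simp [hω]
    · simp [hω]

end LabelProbabilities

/-! ### Rescaling of integrals -/

section Scaling

variable {d : ℕ}

theorem integral_scaled (g : EuclideanSpace ℝ (Fin d) → ℝ) (x : EuclideanSpace ℝ (Fin d)) {h : ℝ}
    (hh : 0 < h) : ∫ x', g (h⁻¹ • (x' - x)) = h ^ d * ∫ u, g u := by
  rw [integral_sub_right_eq_self (fun y => g (h⁻¹ • y)) x,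
    Measure.integral_comp_inv_smul_of_nonneg _ _ hh.le, finrank_euclideanSpace_fin, smul_eq_mul]

theorem integrable_scaled {g : EuclideanSpace ℝ (Fin d) → ℝ} (hg : Integrable g)
    (x : EuclideanSpace ℝ (Fin d)) {h : ℝ} (hh : 0 < h) :
    Integrable fun x' => g (h⁻¹ • (x' - x)) :=
  (hg.comp_smul (inv_ne_zero hh.ne')).comp_sub_right x

theorem integrable_scaled_of_le {Q : Measure (EuclideanSpace ℝ (Fin d))} {b : ℝ}
    (hQ : Q ≤ ENNReal.ofReal b • volume) {g : EuclideanSpace ℝ (Fin d) → ℝ} (hg : Integrable g)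
    (x : EuclideanSpace ℝ (Fin d)) {h : ℝ} (hh : 0 < h) :
    Integrable (fun x' => g (h⁻¹ • (x' - x))) Q :=
  ((integrable_scaled hg x hh).smul_measure ENNReal.ofReal_ne_top).mono_measure hQ

/-- A density bounded by `b` costs a factor `b` in the change of variables `u = (x' - x) / h`. -/
theorem integral_scaled_le {Q : Measure (EuclideanSpace ℝ (Fin d))} {b : ℝ} (hb : 0 ≤ b)
    (hQ : Q ≤ ENNReal.ofReal b • volume) {g : EuclideanSpace ℝ (Fin d) → ℝ} (hg : Integrable g)
    (hg0 : ∀ u, 0 ≤ g u) (x : EuclideanSpace ℝ (Fin d)) {h : ℝ} (hh : 0 < h) :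
    ∫ x', g (h⁻¹ • (x' - x)) ∂Q ≤ b * (h ^ d * ∫ u, g u) := by
  refine (integral_mono_measure hQ (Eventually.of_forall fun _ => hg0 _)
    ((integrable_scaled hg x hh).smul_measure ENNReal.ofReal_ne_top)).trans ?_
  rw [integral_smul_measure, integral_scaled g x hh, ENNReal.toReal_ofReal hb, smul_eq_mul]

end Scaling

/-! ### Moments of the kernel -/

section Kernel

variable {d l : ℕ} {β c L : ℝ} {K : EuclideanSpace ℝ (Fin d) → ℝ}

theorem rpow_le_one_add_rpow {r a b : ℝ} (hr : 0 ≤ r) (ha : 0 ≤ a) (hab : a ≤ b) :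
    r ^ a ≤ 1 + r ^ b := by
  rcases le_total r 1 with h | h
  · have := Real.rpow_le_one hr h ha
    have := Real.rpow_nonneg hr b
    linarith
  · have := Real.rpow_le_rpow_of_exponent_le h hab
    linarith

theorem rpow_mul_abs_mono_le {a b : ℝ} (ha : 0 ≤ a) (s : MonoIdx d l) (hab : a + l ≤ b)
    (u : EuclideanSpace ℝ (Fin d)) : ‖u‖ ^ a * |mono s.1 u| ≤ 1 + ‖u‖ ^ b := by
  have h1 : ‖u‖ ^ a * |mono s.1 u| ≤ ‖u‖ ^ (a + s.1.degree) := by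
    rw [Real.rpow_add_of_nonneg (norm_nonneg _) ha (Nat.cast_nonneg _), Real.rpow_natCast]
    exact mul_le_mul_of_nonneg_left (abs_mono_le _ _) (Real.rpow_nonneg (norm_nonneg _) _)
  have h2 : (s.1.degree : ℝ) ≤ l := by exact_mod_cast s.2
  exact h1.trans (rpow_le_one_add_rpow (norm_nonneg _) (by positivity) (by linarith))

theorem IsAdmissibleKernel.nonneg (hc : 0 < c) (hK : IsAdmissibleKernel β c K)
    (u : EuclideanSpace ℝ (Fin d)) : 0 ≤ K u :=
  le_trans (mul_nonneg hc.le (Set.indicator_nonneg (fun _ _ => zero_le_one) u)) (hK.lower u)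

theorem IsAdmissibleKernel.le_of_mem_ball (hK : IsAdmissibleKernel β c K)
    {u : EuclideanSpace ℝ (Fin d)} (hu : u ∈ Metric.ball 0 c) : c ≤ K u := by
  have := hK.lower u
  rwa [Set.indicator_of_mem (Metric.ball_subset_closedBall hu), mul_one] at this

theorem one_add_mul_abs_mono_le (hβ : 0 < β) (hL : 0 ≤ L) (hl : (l : ℝ) ≤ β) (s : MonoIdx d l)
    (u : EuclideanSpace ℝ (Fin d)) :
    (1 + L * ‖u‖ ^ β) * |mono s.1 u| ≤ (1 + L) * (1 + ‖u‖ ^ (2 * β)) := by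
  have h1 := rpow_mul_abs_mono_le le_rfl s (b := 2 * β) (by linarith) u
  have h2 := rpow_mul_abs_mono_le hβ.le s (b := 2 * β) (by linarith) u
  rw [Real.rpow_zero, one_mul] at h1
  nlinarith

/-- The envelope `(1 + L * ‖u‖ ^ β) * |mono s u| * K u` of the residuals is bounded. -/
theorem IsAdmissibleKernel.exists_envelope_le (hβ : 0 < β) (hL : 0 ≤ L) (hl : (l : ℝ) ≤ β)
    (hc : 0 < c) (hK : IsAdmissibleKernel β c K) :
    ∃ M : ℝ, 0 < M ∧ ∀ (s : MonoIdx d l) u, (1 + L * ‖u‖ ^ β) * |mono s.1 u| * K u ≤ M := by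
  obtain ⟨B, hB⟩ := hK.bddAbove
  refine ⟨(1 + L) * (|B| + 1), by positivity, fun s u => ?_⟩
  have hu : (1 + ‖u‖ ^ (2 * β)) * K u ≤ B := hB ⟨u, rfl⟩
  calc (1 + L * ‖u‖ ^ β) * |mono s.1 u| * K u
      ≤ (1 + L) * (1 + ‖u‖ ^ (2 * β)) * K u :=
        mul_le_mul_of_nonneg_right (one_add_mul_abs_mono_le hβ hL hl s u) (hK.nonneg hc u)
    _ = (1 + L) * ((1 + ‖u‖ ^ (2 * β)) * K u) := by ring
    _ ≤ (1 + L) * (|B| + 1) := by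
        gcongr
        linarith [le_abs_self B]

/-- The envelope of the residuals is square integrable. -/
theorem IsAdmissibleKernel.exists_integral_envelope_sq_le (hβ : 0 < β) (hL : 0 ≤ L)
    (hl : (l : ℝ) ≤ β) (hK : IsAdmissibleKernel β c K) :
    ∃ v : ℝ, 0 < v ∧ ∀ s : MonoIdx d l,
      Integrable (fun u => ((1 + L * ‖u‖ ^ β) * |mono s.1 u| * K u) ^ 2) ∧
      ∫ u, ((1 + L * ‖u‖ ^ β) * |mono s.1 u| * K u) ^ 2 ≤ v := by
  set I := ∫ u, (1 + ‖u‖ ^ (4 * β)) * K u ^ 2 with hI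
  have hI0 : 0 ≤ I := integral_nonneg fun u => by positivity
  have hle : ∀ (s : MonoIdx d l) u, ((1 + L * ‖u‖ ^ β) * |mono s.1 u| * K u) ^ 2
      ≤ 2 * (1 + L) ^ 2 * ((1 + ‖u‖ ^ (4 * β)) * K u ^ 2) := by
    intro s u
    have h1 : ((1 + L * ‖u‖ ^ β) * |mono s.1 u|) ^ 2 ≤ ((1 + L) * (1 + ‖u‖ ^ (2 * β))) ^ 2 :=
      pow_le_pow_left₀ (by positivity) (one_add_mul_abs_mono_le hβ hL hl s u) 2
    have h2 : ‖u‖ ^ (4 * β) = (‖u‖ ^ (2 * β)) ^ 2 := by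
      rw [← Real.rpow_natCast, ← Real.rpow_mul (norm_nonneg _)]
      congr 1
      push_cast
      ring
    have h3 : (1 + ‖u‖ ^ (2 * β)) ^ 2 ≤ 2 * (1 + ‖u‖ ^ (4 * β)) := by
      rw [h2]
      nlinarith [sq_nonneg (1 - ‖u‖ ^ (2 * β))]
    calc ((1 + L * ‖u‖ ^ β) * |mono s.1 u| * K u) ^ 2
        = ((1 + L * ‖u‖ ^ β) * |mono s.1 u|) ^ 2 * K u ^ 2 := by ring
      _ ≤ ((1 + L) * (1 + ‖u‖ ^ (2 * β))) ^ 2 * K u ^ 2 := by gcongr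
      _ = (1 + L) ^ 2 * (1 + ‖u‖ ^ (2 * β)) ^ 2 * K u ^ 2 := by ring
      _ ≤ (1 + L) ^ 2 * (2 * (1 + ‖u‖ ^ (4 * β))) * K u ^ 2 := by gcongr
      _ = _ := by ring
  have hmeas : ∀ s : MonoIdx d l,
      Measurable fun u => ((1 + L * ‖u‖ ^ β) * |mono s.1 u| * K u) ^ 2 := fun s =>
    ((Measurable.mul (by fun_prop) (continuous_mono s.1).abs.measurable).mul
      hK.measurable).pow_const 2
  refine ⟨2 * (1 + L) ^ 2 * (I + 1), by positivity, fun s => ?_⟩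
  have hint := hK.integrable_sq.const_mul (2 * (1 + L) ^ 2)
  have hint' : Integrable (fun u => ((1 + L * ‖u‖ ^ β) * |mono s.1 u| * K u) ^ 2) := by
    refine hint.mono' (hmeas s).aestronglyMeasurable (Eventually.of_forall fun u => ?_)
    rw [Real.norm_eq_abs, abs_of_nonneg (sq_nonneg _)]
    exact hle s u
  refine ⟨hint', (integral_mono hint' hint (hle s)).trans ?_⟩
  rw [integral_const_mul]
  gcongr
  linarith

theorem IsAdmissibleKernel.exists_integral_moment_le (hβ : 0 < β) (hc : 0 < c)
    (hK : IsAdmissibleKernel β c K)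
    (hKmoment : Integrable fun u : EuclideanSpace ℝ (Fin d) => ‖u‖ ^ ((l : ℝ) + β) * K u) :
    ∃ b : ℝ, 0 < b ∧ ∀ s : MonoIdx d l,
      Integrable (fun u => ‖u‖ ^ β * |mono s.1 u| * K u) ∧
      ∫ u, ‖u‖ ^ β * |mono s.1 u| * K u ≤ b := by
  set I := ∫ u, (K u + ‖u‖ ^ ((l : ℝ) + β) * K u) with hI
  have hI0 : 0 ≤ I := integral_nonneg fun u => by
    have := hK.nonneg hc u
    positivity
  have hle : ∀ (s : MonoIdx d l) u,
      ‖u‖ ^ β * |mono s.1 u| * K u ≤ K u + ‖u‖ ^ ((l : ℝ) + β) * K u := by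
    intro s u
    have h1 := mul_le_mul_of_nonneg_right
      (rpow_mul_abs_mono_le hβ.le s (b := (l : ℝ) + β) (by linarith) u) (hK.nonneg hc u)
    linarith
  refine ⟨I + 1, by positivity, fun s => ?_⟩
  have hint : Integrable fun u => K u + ‖u‖ ^ ((l : ℝ) + β) * K u := hK.integrable.add hKmoment
  have hint' : Integrable (fun u => ‖u‖ ^ β * |mono s.1 u| * K u) := by
    refine hint.mono' ?_ (Eventually.of_forall fun u => ?_)
    · exact ((Measurable.mul (by fun_prop) (continuous_mono s.1).abs.measurable).mul
        hK.measurable).aestronglyMeasurable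
    · have := hK.nonneg hc u
      rw [Real.norm_eq_abs, abs_of_nonneg (by positivity)]
      exact hle s u
  exact ⟨hint', (integral_mono hint' hint (hle s)).trans (by linarith)⟩

end Kernel

/-! ### The accumulated drift -/

section Drift

/-- By induction, with Bernoulli's inequality for the power `1 - γ` of `1 - 1 / (n + 1)`. -/
theorem sum_rpow_neg_le {γ : ℝ} (h0 : 0 < γ) (h1 : γ < 1) (n : ℕ) :
    ∑ i ∈ Finset.range n, ((i : ℝ) + 1) ^ (-γ) ≤ (1 - γ)⁻¹ * (n : ℝ) ^ (1 - γ) := by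
  induction n with
  | zero =>
    simp only [Finset.range_zero, Finset.sum_empty]
    have := sub_pos.2 h1
    positivity
  | succ n ih =>
    rw [Finset.sum_range_succ]
    have hp : 0 < 1 - γ := sub_pos.2 h1
    have hn : (0 : ℝ) < n + 1 := by positivity
    have hb := rpow_one_add_le_one_add_mul_self (s := -1 / ((n : ℝ) + 1))
      (by rw [le_div_iff₀ hn]; linarith [(Nat.cast_nonneg n : (0 : ℝ) ≤ n)]) hp.le
      (by linarith : 1 - γ ≤ 1)
    have he : (n : ℝ) = (n + 1) * (1 + -1 / ((n : ℝ) + 1)) := by field_simp; ring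
    have hn1 : (0 : ℝ) ≤ 1 + -1 / ((n : ℝ) + 1) := by
      rw [show (1 : ℝ) + -1 / ((n : ℝ) + 1) = n / (n + 1) by field_simp; ring]
      positivity
    have key : (n : ℝ) ^ (1 - γ) ≤ ((n : ℝ) + 1) ^ (1 - γ) - (1 - γ) * ((n : ℝ) + 1) ^ (-γ) := by
      conv_lhs => rw [he]
      rw [Real.mul_rpow hn.le hn1]
      have h2 : ((n : ℝ) + 1) ^ (1 - γ) = (n + 1) * ((n : ℝ) + 1) ^ (-γ) := by
        rw [sub_eq_add_neg, Real.rpow_add hn, Real.rpow_one]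
      calc ((n : ℝ) + 1) ^ (1 - γ) * (1 + -1 / ((n : ℝ) + 1)) ^ (1 - γ)
          ≤ ((n : ℝ) + 1) ^ (1 - γ) * (1 + (1 - γ) * (-1 / ((n : ℝ) + 1))) := by gcongr
        _ = _ := by
          rw [h2]
          field_simp
          ring
    have h3 := mul_le_mul_of_nonneg_left key (inv_nonneg.2 hp.le)
    rw [mul_sub, ← mul_assoc (1 - γ)⁻¹ (1 - γ), inv_mul_cancel₀ hp.ne', one_mul] at h3
    push_cast
    linarith

variable {d m : ℕ} {Ω : Type*} [MeasurableSpace Ω] {ρ : Measure Ω} [IsProbabilityMeasure ρ]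
  {Q : Measure (EuclideanSpace ℝ (Fin d))} {X : ℕ → Ω → EuclideanSpace ℝ (Fin d)}
  {Y : ℕ → Ω → Fin m} {ηs : ℕ → Fin m → EuclideanSpace ℝ (Fin d) → ℝ}
  {η : Fin m → EuclideanSpace ℝ (Fin d) → ℝ} {β : ℝ}

/-- Almost surely the drift rate holds with one constant for all examples, since the label
probabilities of the first examples differ by at most one. -/
theorem exists_forall_ae_drift_le (hβ : 0 < β) (hData : IsDriftingSample ρ Q ηs X Y)
    (hDrift : HasDriftRate β ηs η) (hη : ∀ j, ∀ᵐ x ∂Q, η j x ∈ Set.Icc (0 : ℝ) 1) :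
    ∃ D : ℝ, 0 < D ∧ ∀ j i, ∀ᵐ ω ∂ρ,
      |(ρ⟦Y i ⁻¹' {j} | MeasurableSpace.comap (X i) inferInstance⟧) ω - η j (X i ω)|
        ≤ D * ((i : ℝ) + 1) ^ (-((β + d) / (2 * β + d))) := by
  set γ := (β + d) / (2 * β + d) with hγ
  have hγ0 : 0 < γ := by positivity
  choose D hD using hDrift
  choose N hN using fun j => eventually_atTop.1 (hD j)
  have hpos : ∀ j, 0 < |D j| + ((N j : ℝ) + 1) ^ γ := fun j => by positivity
  refine ⟨1 + ∑ j, (|D j| + ((N j : ℝ) + 1) ^ γ),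
    add_pos_of_pos_of_nonneg one_pos (Finset.sum_nonneg fun j _ => (hpos j).le), fun j i => ?_⟩
  have hsum : |D j| + ((N j : ℝ) + 1) ^ γ ≤ 1 + ∑ j, (|D j| + ((N j : ℝ) + 1) ^ γ) := by
    have := Finset.single_le_sum (f := fun j => |D j| + ((N j : ℝ) + 1) ^ γ)
      (fun j _ => (hpos j).le) (Finset.mem_univ j)
    linarith
  have hηi : ∀ᵐ ω ∂ρ, η j (X i ω) ∈ Set.Icc (0 : ℝ) 1 := by
    have h := hη j
    rw [← hData.law_X i] at h
    exact ae_of_ae_map (hData.measurable_X i).aemeasurable h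
  filter_upwards [hData.label i j, condProb_mem_Icc (X := X i) (hData.measurable_Y i) j, hηi]
    with ω h1 h2 h3
  refine le_trans ?_ (mul_le_mul_of_nonneg_right hsum (by positivity))
  rcases le_or_gt (N j) i with hi | hi
  · rw [← h1]
    refine (hN j i hi (X i ω)).trans (mul_le_mul_of_nonneg_right ?_ (by positivity))
    exact (le_abs_self _).trans (le_add_of_nonneg_right (by positivity))
  · have h4 : (1 : ℝ) ≤ ((N j : ℝ) + 1) ^ γ * ((i : ℝ) + 1) ^ (-γ) := by
      rw [Real.rpow_neg (by positivity), ← div_eq_mul_inv, one_le_div (by positivity)]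
      have : (i : ℝ) ≤ N j := by exact_mod_cast hi.le
      gcongr
    have h5 : |(ρ⟦Y i ⁻¹' {j} | MeasurableSpace.comap (X i) inferInstance⟧) ω - η j (X i ω)|
        ≤ 1 := abs_sub_le_iff.2 ⟨by linarith [h2.2, h3.1], by linarith [h2.1, h3.2]⟩
    refine h5.trans (h4.trans ?_)
    gcongr
    exact le_add_of_nonneg_left (abs_nonneg _)

end Drift

/-! ### Moments of the residuals -/

section Residual

variable {d l m : ℕ}

/-- The contribution of the example `p` to the `s`-th normal equation at the point `x`, for the
reference polynomial with the coefficients `w`. -/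
def lpResidual (K : EuclideanSpace ℝ (Fin d) → ℝ) (h : ℝ) (j : Fin m)
    (x : EuclideanSpace ℝ (Fin d)) (w : MonoIdx d l → ℝ) (s : MonoIdx d l)
    (p : EuclideanSpace ℝ (Fin d) × Fin m) : ℝ :=
  ((if p.2 = j then (1 : ℝ) else 0) - polyVal w (h⁻¹ • (p.1 - x)))
    * mono s.1 (h⁻¹ • (p.1 - x)) * K (h⁻¹ • (p.1 - x))

/-- The polynomial with coefficients `w`, at the scale `h` around `x`, approximates `g` with the
Hölder error. -/
def IsHolderApprox (β L h : ℝ) (g : EuclideanSpace ℝ (Fin d) → ℝ) (x : EuclideanSpace ℝ (Fin d))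
    (w : MonoIdx d l → ℝ) : Prop :=
  ∀ x', |g x' - polyVal w (h⁻¹ • (x' - x))| ≤ L * (h ^ β * ‖h⁻¹ • (x' - x)‖ ^ β)

/-- The rescaled Taylor polynomial is a Hölder approximation, and it is exact at the base point. -/
theorem IsHolderClass.exists_approx {β L h : ℝ} (hβ : 0 < β) (hh : 0 < h)
    {g : EuclideanSpace ℝ (Fin d) → ℝ} (hg : IsHolderClass β l L g)
    (x : EuclideanSpace ℝ (Fin d)) :
    ∃ w : MonoIdx d l → ℝ, IsHolderApprox β L h g x w ∧ polyVal w 0 = g x := by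
  obtain ⟨θ, hθ, hT⟩ := exists_polynomial_eq_taylorPoly (l := l) g x
  obtain ⟨w, rfl⟩ := exists_scaledPoly_eq hh.ne' hθ
  simp only [eval_scaledPoly] at hT
  refine ⟨w, fun x' => ?_, ?_⟩
  · rw [← hT]
    refine (hg.2 x x').trans (le_of_eq ?_)
    rw [← Real.mul_rpow hh.le (norm_nonneg _), norm_smul, norm_inv, Real.norm_of_nonneg hh.le,
      mul_inv_cancel_left₀ hh.ne', norm_sub_rev]
  · have h0 := hg.2 x x
    rw [hT, sub_self, norm_zero, Real.zero_rpow hβ.ne', mul_zero, smul_zero] at h0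
    linarith [abs_nonpos_iff.1 h0]

theorem measurable_lpResidual {K : EuclideanSpace ℝ (Fin d) → ℝ} (hK : Measurable K) (h : ℝ)
    (j : Fin m) (x : EuclideanSpace ℝ (Fin d)) (w : MonoIdx d l → ℝ) (s : MonoIdx d l) :
    Measurable (lpResidual K h j x w s) := by
  have hu : Measurable fun p : EuclideanSpace ℝ (Fin d) × Fin m => h⁻¹ • (p.1 - x) := by fun_prop
  exact (((measurable_labelIndicator measurable_snd j).sub
    ((continuous_polyVal w).measurable.comp hu)).mul
    ((continuous_mono s.1).measurable.comp hu)).mul (hK.comp hu)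

variable {Ω : Type*} [MeasurableSpace Ω] {ρ : Measure Ω}
  {X : Ω → EuclideanSpace ℝ (Fin d)} {Y : Ω → Fin m} {K : EuclideanSpace ℝ (Fin d) → ℝ}
  {β L h : ℝ} {g : EuclideanSpace ℝ (Fin d) → ℝ} {x : EuclideanSpace ℝ (Fin d)}
  {w : MonoIdx d l → ℝ}

theorem abs_lpResidual_le (hK0 : ∀ u, 0 ≤ K u) (hβ : 0 < β) (hL : 0 ≤ L) (hh : 0 < h) (hh1 : h ≤ 1)
    (hw : IsHolderApprox β L h g x w) (j : Fin m) (s : MonoIdx d l)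
    (p : EuclideanSpace ℝ (Fin d) × Fin m) (hp : g p.1 ∈ Set.Icc (0 : ℝ) 1) :
    |lpResidual K h j x w s p| ≤ (1 + L * ‖h⁻¹ • (p.1 - x)‖ ^ β)
      * |mono s.1 (h⁻¹ • (p.1 - x))| * K (h⁻¹ • (p.1 - x)) := by
  rw [lpResidual, abs_mul, abs_mul, abs_of_nonneg (hK0 _)]
  gcongr
  · exact hK0 _
  have h1 : |(if p.2 = j then (1 : ℝ) else 0) - g p.1| ≤ 1 := by
    split_ifs
    · exact abs_sub_le_iff.2 ⟨by linarith [hp.1], by linarith [hp.2]⟩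
    · exact abs_sub_le_iff.2 ⟨by linarith [hp.1], by linarith [hp.2]⟩
  have h2 : L * (h ^ β * ‖h⁻¹ • (p.1 - x)‖ ^ β) ≤ L * (1 * ‖h⁻¹ • (p.1 - x)‖ ^ β) := by
    gcongr
    exact Real.rpow_le_one hh.le hh1 hβ.le
  have h3 := abs_sub_le (if p.2 = j then (1 : ℝ) else 0) (g p.1) (polyVal w (h⁻¹ • (p.1 - x)))
  linarith [hw p.1]

theorem integral_lpResidual_sq_le (hX : Measurable X) (hK0 : ∀ u, 0 ≤ K u)
    (hβ : 0 < β) (hL : 0 ≤ L) (hh : 0 < h) (hh1 : h ≤ 1) (hw : IsHolderApprox β L h g x w)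
    (hg : ∀ᵐ ω ∂ρ, g (X ω) ∈ Set.Icc (0 : ℝ) 1) {b v : ℝ} (hb : 0 ≤ b)
    (hQ : ρ.map X ≤ ENNReal.ofReal b • volume) (j : Fin m) (s : MonoIdx d l)
    (hint : Integrable fun u => ((1 + L * ‖u‖ ^ β) * |mono s.1 u| * K u) ^ 2)
    (hv : ∫ u, ((1 + L * ‖u‖ ^ β) * |mono s.1 u| * K u) ^ 2 ≤ v) :
    ∫ ω, lpResidual K h j x w s (X ω, Y ω) ^ 2 ∂ρ ≤ b * v * h ^ d := by
  set G : EuclideanSpace ℝ (Fin d) → ℝ := fun u => ((1 + L * ‖u‖ ^ β) * |mono s.1 u| * K u) ^ 2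
    with hG
  have hGint := integrable_scaled_of_le hQ hint x hh
  have hle : ∫ ω, lpResidual K h j x w s (X ω, Y ω) ^ 2 ∂ρ ≤ ∫ ω, G (h⁻¹ • (X ω - x)) ∂ρ := by
    refine integral_mono_of_nonneg (Eventually.of_forall fun ω => sq_nonneg _)
      (hGint.comp_measurable hX) ?_
    filter_upwards [hg] with ω hω
    refine sq_le_sq' ?_ ?_
    · exact (abs_le.1 (abs_lpResidual_le hK0 hβ hL hh hh1 hw j s (X ω, Y ω) hω)).1
    · exact (abs_le.1 (abs_lpResidual_le hK0 hβ hL hh hh1 hw j s (X ω, Y ω) hω)).2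
  have hmap : ∫ ω, G (h⁻¹ • (X ω - x)) ∂ρ = ∫ x', G (h⁻¹ • (x' - x)) ∂(ρ.map X) :=
    (integral_map hX.aemeasurable hGint.aestronglyMeasurable).symm
  refine hle.trans ?_
  rw [hmap]
  refine (integral_scaled_le hb hQ hint (fun u => sq_nonneg _) x hh).trans ?_
  calc b * (h ^ d * ∫ u, G u) ≤ b * (h ^ d * v) := by gcongr
    _ = b * v * h ^ d := by ring

/-- The bias of the residuals is the sum of the drift and the Hölder error. -/
theorem abs_integral_lpResidual_le [IsProbabilityMeasure ρ] (hX : Measurable X)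
    (hY : Measurable Y) (hK : Measurable K) (hK0 : ∀ u, 0 ≤ K u) (hβ : 0 < β)
    (hL : 0 ≤ L) (hh : 0 < h) (hh1 : h ≤ 1) (hw : IsHolderApprox β L h g x w)
    (hg : ∀ᵐ ω ∂ρ, g (X ω) ∈ Set.Icc (0 : ℝ) 1) {b B M D : ℝ} (hb : 0 ≤ b)
    (hQ : ρ.map X ≤ ENNReal.ofReal b • volume) (j : Fin m) (s : MonoIdx d l)
    (hM : ∀ u, (1 + L * ‖u‖ ^ β) * |mono s.1 u| * K u ≤ M)
    (hint : Integrable fun u => ‖u‖ ^ β * |mono s.1 u| * K u)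
    (hB : ∫ u, ‖u‖ ^ β * |mono s.1 u| * K u ≤ B) (hD0 : 0 ≤ D)
    (hD : ∀ᵐ ω ∂ρ,
      |(ρ⟦Y ⁻¹' {j} | MeasurableSpace.comap X inferInstance⟧) ω - g (X ω)| ≤ D) :
    |∫ ω, lpResidual K h j x w s (X ω, Y ω) ∂ρ| ≤ D * M + L * h ^ β * (b * B * h ^ d) := by
  set e := ρ⟦Y ⁻¹' {j} | MeasurableSpace.comap X inferInstance⟧ with he
  set u : EuclideanSpace ℝ (Fin d) → EuclideanSpace ℝ (Fin d) := fun x' => h⁻¹ • (x' - x) with hu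
  have hum : Measurable u := by fun_prop
  set φ : EuclideanSpace ℝ (Fin d) → ℝ := fun x' => mono s.1 (u x') * K (u x') with hφ
  have hφm : Measurable φ := ((continuous_mono s.1).measurable.comp hum).mul (hK.comp hum)
  have hφM : ∀ x', |φ x'| ≤ M := by
    intro x'
    rw [hφ, abs_mul, abs_of_nonneg (hK0 _)]
    refine le_trans ?_ (hM (u x'))
    have : 0 ≤ L * ‖u x'‖ ^ β * |mono s.1 (u x')| * K (u x') := by
      have := hK0 (u x')
      positivity
    linarith
  have hres : ∀ ω, lpResidual K h j x w s (X ω, Y ω)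
      = (if Y ω = j then (1 : ℝ) else 0) * φ (X ω) - polyVal w (u (X ω)) * φ (X ω) := by
    intro ω
    simp only [lpResidual, hφ, hu]
    ring
  have hi1 : Integrable (fun ω => lpResidual K h j x w s (X ω, Y ω)) ρ := by
    refine Integrable.of_bound ((measurable_lpResidual hK h j x w s).comp
      (hX.prodMk hY)).aestronglyMeasurable M ?_
    filter_upwards [hg] with ω hω
    exact (abs_lpResidual_le hK0 hβ hL hh hh1 hw j s (X ω, Y ω) hω).trans (hM _)
  have hi2 : Integrable (fun ω => (if Y ω = j then (1 : ℝ) else 0) * φ (X ω)) ρ := by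
    refine Integrable.of_bound ((measurable_labelIndicator hY j).mul
      (hφm.comp hX)).aestronglyMeasurable M (Eventually.of_forall fun ω => ?_)
    have h0 := (abs_nonneg _).trans (hφM (X ω))
    split_ifs
    · simpa using hφM (X ω)
    · simpa using h0
  have hi3 : Integrable (fun ω => polyVal w (u (X ω)) * φ (X ω)) ρ := by
    refine (hi2.sub hi1).congr (Eventually.of_forall fun ω => ?_)
    simp only [Pi.sub_apply, hres]
    ring
  have hi4 : Integrable (fun ω => e ω * φ (X ω)) ρ :=
    integrable_condExp.mul_bdd (c := M) (hφm.comp hX).aestronglyMeasurable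
      (Eventually.of_forall fun ω => by simpa using hφM (X ω))
  have hGint := integrable_scaled_of_le hQ hint x hh
  have hGint' : Integrable (fun ω => ‖u (X ω)‖ ^ β * |mono s.1 (u (X ω))| * K (u (X ω))) ρ :=
    hGint.comp_measurable hX
  have heq : ∫ ω, lpResidual K h j x w s (X ω, Y ω) ∂ρ
      = ∫ ω, (e ω - polyVal w (u (X ω))) * φ (X ω) ∂ρ := by
    simp only [hres, sub_mul]
    rw [integral_sub hi2 hi3, integral_sub hi4 hi3,
      integral_labelIndicator_mul_eq hX hY j hφm hφM]
  rw [heq]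
  have hmap : ∫ ω, ‖u (X ω)‖ ^ β * |mono s.1 (u (X ω))| * K (u (X ω)) ∂ρ
      = ∫ x', ‖u x'‖ ^ β * |mono s.1 (u x')| * K (u x') ∂(ρ.map X) :=
    (integral_map hX.aemeasurable hGint.aestronglyMeasurable).symm
  calc |∫ ω, (e ω - polyVal w (u (X ω))) * φ (X ω) ∂ρ|
      ≤ ∫ ω, |(e ω - polyVal w (u (X ω))) * φ (X ω)| ∂ρ := abs_integral_le_integral_abs
    _ ≤ ∫ ω, (D * M + L * h ^ β * (‖u (X ω)‖ ^ β * |mono s.1 (u (X ω))| * K (u (X ω)))) ∂ρ := by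
      refine integral_mono_of_nonneg (Eventually.of_forall fun ω => abs_nonneg _)
        ((integrable_const _).add (hGint'.const_mul _)) ?_
      filter_upwards [hD] with ω hω
      have h1 := abs_sub_le (e ω) (g (X ω)) (polyVal w (u (X ω)))
      have h2 := hw (X ω)
      have h3 : |φ (X ω)| = |mono s.1 (u (X ω))| * K (u (X ω)) := by
        rw [hφ, abs_mul, abs_of_nonneg (hK0 _)]
      rw [abs_mul]
      calc |e ω - polyVal w (u (X ω))| * |φ (X ω)|
          ≤ (D + L * (h ^ β * ‖u (X ω)‖ ^ β)) * |φ (X ω)| := by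
            gcongr
            linarith
        _ = D * |φ (X ω)| + L * (h ^ β * ‖u (X ω)‖ ^ β) * |φ (X ω)| := by ring
        _ ≤ D * M + L * (h ^ β * ‖u (X ω)‖ ^ β) * |φ (X ω)| := by
            gcongr
            exact hφM _
        _ = _ := by
            rw [h3]
            ring
    _ = D * M + L * h ^ β * ∫ x', ‖u x'‖ ^ β * |mono s.1 (u x')| * K (u x') ∂(ρ.map X) := by
      rw [integral_add (integrable_const _) (hGint'.const_mul _),
        integral_const_mul (L * h ^ β), hmap]
      simp
    _ ≤ D * M + L * h ^ β * (b * B * h ^ d) := by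
      have h1 := integral_scaled_le hb hQ hint (fun u => by
        have := hK0 u
        positivity) x hh
      have h2 : b * (h ^ d * ∫ u, ‖u‖ ^ β * |mono s.1 u| * K u) ≤ b * B * h ^ d := by
        calc b * (h ^ d * ∫ u, ‖u‖ ^ β * |mono s.1 u| * K u) ≤ b * (h ^ d * B) := by gcongr
          _ = _ := by ring
      gcongr
      exact h1.trans h2

end Residual

/-! ### The bandwidth and the effective sample size -/

section Bandwidth

variable {d n : ℕ} {β h : ℝ}

theorem bandwidth_pos (hn : 0 < n) (hh : h = (n : ℝ) ^ (-(1 / (2 * β + d)))) : 0 < h := by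
  rw [hh]
  positivity

theorem bandwidth_le_one (hβ : 0 < β) (hn : 0 < n) (hh : h = (n : ℝ) ^ (-(1 / (2 * β + d)))) :
    h ≤ 1 := by
  rw [hh]
  refine Real.rpow_le_one_of_one_le_of_nonpos (by exact_mod_cast hn) ?_
  rw [neg_nonpos]
  positivity

theorem bandwidth_rpow (hh : h = (n : ℝ) ^ (-(1 / (2 * β + d)))) (a : ℝ) :
    h ^ a = (n : ℝ) ^ (-(a / (2 * β + d))) := by
  rw [hh, ← Real.rpow_mul (Nat.cast_nonneg n)]
  congr 1
  ring

/-- The bandwidth balances the standard deviation `(n * h ^ d) ^ (-1/2)` and the bias `h ^ β`. -/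
theorem effective_size_mul_sq (hβ : 0 < β) (hn : 0 < n)
    (hh : h = (n : ℝ) ^ (-(1 / (2 * β + d)))) : n * h ^ d * (h ^ β) ^ 2 = 1 := by
  have hn' : (0 : ℝ) < n := by exact_mod_cast hn
  rw [← Real.rpow_natCast h d, ← Real.rpow_natCast (h ^ β),
    ← Real.rpow_mul (bandwidth_pos hn hh).le,
    bandwidth_rpow hh, bandwidth_rpow hh, ← Real.rpow_one_add' hn'.le, ← Real.rpow_add hn']
  · refine Eq.trans ?_ (Real.rpow_zero (n : ℝ))
    congr 1
    push_cast
    field_simp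
    ring
  · have : 1 + -((d : ℝ) / (2 * β + d)) = 2 * β / (2 * β + d) := by
      field_simp
      ring
    rw [this]
    positivity

/-- The accumulated drift is of the order of the accumulated bias. -/
theorem effective_size_mul_rate (hβ : 0 < β) (hn : 0 < n)
    (hh : h = (n : ℝ) ^ (-(1 / (2 * β + d)))) :
    (n : ℝ) ^ (1 - (β + d) / (2 * β + d)) = n * h ^ d * h ^ β := by
  have hn' : (0 : ℝ) < n := by exact_mod_cast hn
  have h1 : (n : ℝ) * (n : ℝ) ^ (-((d : ℝ) / (2 * β + d)))
      = (n : ℝ) ^ (1 + -((d : ℝ) / (2 * β + d))) := by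
    rw [Real.rpow_add hn', Real.rpow_one]
  rw [← Real.rpow_natCast h d, bandwidth_rpow hh, bandwidth_rpow hh, h1,
    ← Real.rpow_add hn']
  congr 1
  field_simp
  ring

end Bandwidth

/-! ### Concentration of the residuals and the mean design -/

section Concentration

variable {d l m : ℕ} {Ω : Type*} [MeasurableSpace Ω] {ρ : Measure Ω} [IsProbabilityMeasure ρ]
  {Q : Measure (EuclideanSpace ℝ (Fin d))} {X : ℕ → Ω → EuclideanSpace ℝ (Fin d)}
  {Y : ℕ → Ω → Fin m} {ηs : ℕ → Fin m → EuclideanSpace ℝ (Fin d) → ℝ}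
  {η : Fin m → EuclideanSpace ℝ (Fin d) → ℝ} {K : EuclideanSpace ℝ (Fin d) → ℝ}
  {β L c b : ℝ}

/-- The right-hand sides of the normal equations, centered at a Hölder approximation, concentrate
around a bias of the order of the rate. -/
theorem exists_lpResidual_tail (hd : 1 ≤ d) (hβ : 0 < β) (hl : (l : ℝ) ≤ β) (hL : 0 ≤ L)
    (hc : 0 < c) (hb : 0 < b) (hK : IsAdmissibleKernel β c K)
    (hKmoment : Integrable fun u : EuclideanSpace ℝ (Fin d) => ‖u‖ ^ ((l : ℝ) + β) * K u)
    (hQ : Q ≤ ENNReal.ofReal b • volume) (hη : ∀ j, ∀ᵐ x ∂Q, η j x ∈ Set.Icc (0 : ℝ) 1)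
    (hData : IsDriftingSample ρ Q ηs X Y) (hDrift : HasDriftRate β ηs η) :
    ∃ κ A : ℝ, 0 < κ ∧ 0 < A ∧ ∀ n : ℕ, 0 < n → ∀ h : ℝ, h = (n : ℝ) ^ (-(1 / (2 * β + d))) →
      ∀ (x : EuclideanSpace ℝ (Fin d)) (j : Fin m) (w : MonoIdx d l → ℝ),
      IsHolderApprox β L h (η j) x w → ∀ (s : MonoIdx d l) (δ : ℝ), 0 ≤ δ → δ ≤ 1 →
      ρ.real {ω | n * h ^ d * (δ + A * h ^ β)
          ≤ |∑ i ∈ Finset.range n, lpResidual K h j x w s (X i ω, Y i ω)|}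
        ≤ 2 * Real.exp (-κ * (n * h ^ d * δ ^ 2)) := by
  have hd' : (1 : ℝ) ≤ d := by exact_mod_cast hd
  obtain ⟨M, hM0, hM⟩ := hK.exists_envelope_le (l := l) (L := L) hβ hL hl hc
  obtain ⟨v, hv0, hv⟩ := hK.exists_integral_envelope_sq_le (l := l) (L := L) hβ hL hl
  obtain ⟨B, hB0, hB⟩ := hK.exists_integral_moment_le hβ hc hKmoment
  obtain ⟨D, hD0, hD⟩ := exists_forall_ae_drift_le hβ hData hDrift hη
  set γ := (β + d) / (2 * β + d) with hγ
  have hγ0 : 0 < γ := by positivity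
  have hγ1 : γ < 1 := by
    rw [hγ, div_lt_one (by positivity)]
    linarith
  have h1γ : 0 < 1 - γ := sub_pos.2 hγ1
  set A := D * M * (1 - γ)⁻¹ + L * (b * B) with hA
  have hA0 : 0 < A := by positivity
  have hbv : 0 < b * v := by positivity
  refine ⟨min M⁻¹ (2 * (b * v))⁻¹ / 2, A, by positivity, hA0, ?_⟩
  intro n hn h hh x j w hw s δ hδ0 hδ1
  have hh0 : 0 < h := bandwidth_pos hn hh
  have hh1 : h ≤ 1 := bandwidth_le_one hβ hn hh
  have hηX : ∀ i, ∀ᵐ ω ∂ρ, η j (X i ω) ∈ Set.Icc (0 : ℝ) 1 := by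
    intro i
    have := hη j
    rw [← hData.law_X i] at this
    exact ae_of_ae_map (hData.measurable_X i).aemeasurable this
  have hQi : ∀ i, ρ.map (X i) ≤ ENNReal.ofReal b • volume := fun i => by
    rw [hData.law_X i]
    exact hQ
  have hmeas := measurable_lpResidual hK.measurable h j x w s
  set ξ : ℕ → Ω → ℝ := fun i ω => lpResidual K h j x w s (X i ω, Y i ω) with hξ
  have hξm : ∀ i, Measurable (ξ i) := fun i =>
    hmeas.comp ((hData.measurable_X i).prodMk (hData.measurable_Y i))
  have hξind : iIndepFun ξ ρ := hData.indep.comp (fun _ => lpResidual K h j x w s) fun _ => hmeas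
  have hξM : ∀ i, ∀ᵐ ω ∂ρ, |ξ i ω| ≤ M := fun i => by
    filter_upwards [hηX i] with ω hω
    exact (abs_lpResidual_le (hK.nonneg hc) hβ hL hh0 hh1 hw j s (X i ω, Y i ω) hω).trans (hM _ _)
  have hξv : ∑ i ∈ Finset.range n, ∫ ω, ξ i ω ^ 2 ∂ρ ≤ b * v * (n * h ^ d) := by
    calc ∑ i ∈ Finset.range n, ∫ ω, ξ i ω ^ 2 ∂ρ ≤ ∑ _i ∈ Finset.range n, b * v * h ^ d :=
          Finset.sum_le_sum fun i _ => integral_lpResidual_sq_le (hData.measurable_X i)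
            (hK.nonneg hc) hβ hL hh0 hh1 hw (hηX i) hb.le (hQi i) j s (hv s).1 (hv s).2
      _ = b * v * (n * h ^ d) := by
          rw [Finset.sum_const, Finset.card_range, nsmul_eq_mul]
          ring
  have hbias : |∑ i ∈ Finset.range n, ∫ ω, ξ i ω ∂ρ| ≤ n * h ^ d * (A * h ^ β) := by
    calc |∑ i ∈ Finset.range n, ∫ ω, ξ i ω ∂ρ|
        ≤ ∑ i ∈ Finset.range n, |∫ ω, ξ i ω ∂ρ| := Finset.abs_sum_le_sum_abs _ _
      _ ≤ ∑ i ∈ Finset.range n,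
          (D * ((i : ℝ) + 1) ^ (-γ) * M + L * h ^ β * (b * B * h ^ d)) :=
          Finset.sum_le_sum fun i _ => abs_integral_lpResidual_le (hData.measurable_X i)
            (hData.measurable_Y i) hK.measurable (hK.nonneg hc) hβ hL hh0 hh1 hw (hηX i) hb.le
            (hQi i) j s (hM s) (hB s).1 (hB s).2 (by positivity) (hD j i)
      _ = D * M * ∑ i ∈ Finset.range n, ((i : ℝ) + 1) ^ (-γ)
          + n * h ^ d * (L * (b * B) * h ^ β) := by
          rw [Finset.sum_add_distrib, Finset.sum_const, Finset.card_range, nsmul_eq_mul,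
            Finset.mul_sum]
          congr 1
          · exact Finset.sum_congr rfl fun i _ => by ring
          · ring
      _ ≤ D * M * ((1 - γ)⁻¹ * (n : ℝ) ^ (1 - γ)) + n * h ^ d * (L * (b * B) * h ^ β) := by
          gcongr
          exact sum_rpow_neg_le hγ0 hγ1 n
      _ = n * h ^ d * (A * h ^ β) := by
          rw [hγ, effective_size_mul_rate hβ hn hh, hA]
          ring
  have hsub : {ω | n * h ^ d * (δ + A * h ^ β) ≤ |∑ i ∈ Finset.range n, ξ i ω|}
      ⊆ {ω | n * h ^ d * δ
        ≤ |∑ i ∈ Finset.range n, ξ i ω - ∑ i ∈ Finset.range n, ∫ ω, ξ i ω ∂ρ|} := by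
    intro ω hω
    simp only [Set.mem_ofPred_eq] at hω ⊢
    have := abs_sub_abs_le_abs_sub (∑ i ∈ Finset.range n, ξ i ω)
      (∑ i ∈ Finset.range n, ∫ ω, ξ i ω ∂ρ)
    linarith
  exact (measureReal_mono hsub).trans (measure_abs_sum_sub_ge_le hξm hξind _ hξM hM0 hbv
    (by positivity) hδ0 hδ1 hξv)

/-- The product of two monomials, restricted to the ball of radius `c`: the entries of the
truncated design matrix. -/
def designEntry (c : ℝ) (s t : MonoIdx d l) (u : EuclideanSpace ℝ (Fin d)) : ℝ :=
  (Metric.ball 0 c).indicator (fun u => mono s.1 u * mono t.1 u) u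

theorem measurable_designEntry (c : ℝ) (s t : MonoIdx d l) : Measurable (designEntry c s t) :=
  ((continuous_mono s.1).mul (continuous_mono t.1)).measurable.indicator
    Metric.isOpen_ball.measurableSet

theorem abs_designEntry_le (hc : 0 < c) (s t : MonoIdx d l) (u : EuclideanSpace ℝ (Fin d)) :
    |designEntry c s t u| ≤ (Metric.ball 0 c).indicator (fun _ => ((1 + c) ^ l) ^ 2) u := by
  by_cases hu : u ∈ Metric.ball (0 : EuclideanSpace ℝ (Fin d)) c
  · rw [designEntry, Set.indicator_of_mem hu, Set.indicator_of_mem hu, abs_mul, sq]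
    have h : ∀ r : MonoIdx d l, |mono r.1 u| ≤ (1 + c) ^ l := fun r => by
      refine (abs_mono_le _ _).trans ?_
      have h1 : ‖u‖ ≤ 1 + c := by linarith [mem_ball_zero_iff.1 hu]
      calc ‖u‖ ^ r.1.degree ≤ (1 + c) ^ r.1.degree := by gcongr
        _ ≤ (1 + c) ^ l := pow_le_pow_right₀ (by linarith) r.2
    exact mul_le_mul (h s) (h t) (abs_nonneg _) (by positivity)
  · rw [designEntry, Set.indicator_of_notMem hu, Set.indicator_of_notMem hu, abs_zero]

theorem sum_sum_mul_designEntry (w : MonoIdx d l → ℝ) (u : EuclideanSpace ℝ (Fin d)) :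
    ∑ s, ∑ t, w s * w t * designEntry c s t u
      = (Metric.ball 0 c).indicator (fun u => polyVal w u ^ 2) u := by
  by_cases hu : u ∈ Metric.ball (0 : EuclideanSpace ℝ (Fin d)) c
  · simp only [designEntry, Set.indicator_of_mem hu, polyVal, sq, Finset.sum_mul_sum]
    exact Finset.sum_congr rfl fun s _ => Finset.sum_congr rfl fun t _ => by ring
  · simp [designEntry, Set.indicator_of_notMem hu]

/-- The mean design form of one observation, bounded below through the part of the law on `A`. -/
theorem sum_integral_designEntry_ge {A : Set (EuclideanSpace ℝ (Fin d))} (hA : MeasurableSet A)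
    {a h κ : ℝ} (ha : 0 ≤ a) (hh : 0 < h) (hc : 0 < c) [IsFiniteMeasure Q]
    (hQ : ENNReal.ofReal a • volume.restrict A ≤ Q) (x : EuclideanSpace ℝ (Fin d))
    (hκ : ∀ w : MonoIdx d l → ℝ, κ * ∑ s, w s ^ 2
      ≤ ∫ u in {u | x + h • u ∈ A} ∩ Metric.ball 0 c, polyVal w u ^ 2) (w : MonoIdx d l → ℝ) :
    a * h ^ d * κ * ∑ s, w s ^ 2
      ≤ ∑ s, ∑ t, w s * w t * ∫ x', designEntry c s t (h⁻¹ • (x' - x)) ∂Q := by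
  have hu : Measurable fun x' : EuclideanSpace ℝ (Fin d) => h⁻¹ • (x' - x) := by fun_prop
  have hint : ∀ s t : MonoIdx d l,
      Integrable (fun x' => designEntry c s t (h⁻¹ • (x' - x))) Q := fun s t => by
    refine Integrable.of_bound ((measurable_designEntry c s t).comp hu).aestronglyMeasurable
      (((1 + c) ^ l) ^ 2) (Eventually.of_forall fun x' => ?_)
    exact (abs_designEntry_le hc s t _).trans
      (Set.indicator_le_self' (fun _ _ => by positivity) _)
  have hsum : ∑ s, ∑ t, w s * w t * ∫ x', designEntry c s t (h⁻¹ • (x' - x)) ∂Q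
      = ∫ x', (Metric.ball 0 c).indicator (fun u => polyVal w u ^ 2) (h⁻¹ • (x' - x)) ∂Q := by
    simp only [← sum_sum_mul_designEntry]
    rw [integral_finsetSum _ fun s _ => integrable_finsetSum _ fun t _ =>
      (hint s t).const_mul _]
    refine Finset.sum_congr rfl fun s _ => ?_
    rw [integral_finsetSum _ fun t _ => (hint s t).const_mul _]
    exact Finset.sum_congr rfl fun t _ => (integral_const_mul _ _).symm
  have hQint : Integrable (fun x' =>
      (Metric.ball 0 c).indicator (fun u => polyVal w u ^ 2) (h⁻¹ • (x' - x))) Q := by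
    simp only [← sum_sum_mul_designEntry]
    exact integrable_finsetSum _ fun s _ => integrable_finsetSum _ fun t _ =>
      (hint s t).const_mul _
  have hmono := integral_mono_measure hQ (Eventually.of_forall fun x' =>
    Set.indicator_nonneg (fun u _ => sq_nonneg (polyVal w u)) (h⁻¹ • (x' - x))) hQint
  rw [hsum]
  refine le_trans (le_of_le_of_eq
    (b := a * (h ^ d * ∫ u in {u | x + h • u ∈ A} ∩ Metric.ball 0 c, polyVal w u ^ 2)) ?_ ?_) hmono
  · calc a * h ^ d * κ * ∑ s, w s ^ 2 = a * (h ^ d * (κ * ∑ s, w s ^ 2)) := by ring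
      _ ≤ _ := by
        gcongr
        exact hκ w
  · rw [integral_smul_measure, ENNReal.toReal_ofReal ha, smul_eq_mul, ← integral_indicator hA]
    congr 1
    have hS : MeasurableSet {u : EuclideanSpace ℝ (Fin d) | x + h • u ∈ A} :=
      hA.preimage (by fun_prop)
    rw [← integral_indicator (hS.inter Metric.isOpen_ball.measurableSet),
      ← integral_scaled _ x hh]
    congr 1
    funext x'
    have hx' : x + h • (h⁻¹ • (x' - x)) = x' := by
      rw [smul_inv_smul₀ hh.ne', add_sub_cancel]
    by_cases hxA : x' ∈ A
    · rw [Set.indicator_of_mem hxA]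
      by_cases hb : h⁻¹ • (x' - x) ∈ Metric.ball (0 : EuclideanSpace ℝ (Fin d)) c
      · rw [Set.indicator_of_mem hb, Set.indicator_of_mem]
        exact ⟨by rw [Set.mem_ofPred_eq, hx']; exact hxA, hb⟩
      · rw [Set.indicator_of_notMem hb, Set.indicator_of_notMem]
        exact fun hmem => hb hmem.2
    · rw [Set.indicator_of_notMem hxA, Set.indicator_of_notMem]
      intro hmem
      have := hmem.1
      rw [Set.mem_ofPred_eq, hx'] at this
      exact hxA this

end Concentration

/-! ### Nondegeneracy of the design -/

section Design

variable {d l m : ℕ} {Ω : Type*} [MeasurableSpace Ω] {ρ : Measure Ω} [IsProbabilityMeasure ρ]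
  {Q : Measure (EuclideanSpace ℝ (Fin d))} {X : ℕ → Ω → EuclideanSpace ℝ (Fin d)}
  {Y : ℕ → Ω → Fin m} {ηs : ℕ → Fin m → EuclideanSpace ℝ (Fin d) → ℝ}
  {η : Fin m → EuclideanSpace ℝ (Fin d) → ℝ} {K : EuclideanSpace ℝ (Fin d) → ℝ}
  {β L c a b c₀ r₀ : ℝ} {A : Set (EuclideanSpace ℝ (Fin d))}

theorem measureReal_inter_ball (hA : MeasurableSet A) (x : EuclideanSpace ℝ (Fin d)) {h : ℝ}
    (hh : 0 < h) (c : ℝ) : volume.real (A ∩ Metric.ball x (h * c))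
      = h ^ d * volume.real ({u | x + h • u ∈ A} ∩ Metric.ball 0 c) := by
  have hS : MeasurableSet {u : EuclideanSpace ℝ (Fin d) | x + h • u ∈ A} :=
    hA.preimage (by fun_prop)
  rw [← integral_indicator_one (hA.inter Metric.isOpen_ball.measurableSet),
    ← integral_indicator_one (hS.inter Metric.isOpen_ball.measurableSet),
    ← integral_scaled _ x hh]
  congr 1
  funext x'
  have hmem : h⁻¹ • (x' - x) ∈ {u | x + h • u ∈ A} ∩ Metric.ball 0 c
      ↔ x' ∈ A ∩ Metric.ball x (h * c) := by
    refine and_congr ?_ ?_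
    · rw [Set.mem_ofPred_eq, smul_inv_smul₀ hh.ne', add_sub_cancel]
    · rw [mem_ball_zero_iff, mem_ball_iff_norm, norm_smul, norm_inv, Real.norm_of_nonneg hh.le,
        inv_mul_lt_iff₀ hh]
  by_cases hx : x' ∈ A ∩ Metric.ball x (h * c)
  · rw [Set.indicator_of_mem hx, Set.indicator_of_mem (hmem.2 hx)]
    rfl
  · rw [Set.indicator_of_notMem hx, Set.indicator_of_notMem fun h => hx (hmem.1 h)]

theorem IsRegularSet.measureReal_ge (hreg : IsRegularSet c₀ r₀ A) (hA : MeasurableSet A)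
    (hc₀ : 0 < c₀) (hc : 0 < c) {h : ℝ} (hh : 0 < h) (hr : h * c ≤ r₀)
    {x : EuclideanSpace ℝ (Fin d)} (hx : x ∈ A) :
    c₀ * volume.real (Metric.ball (0 : EuclideanSpace ℝ (Fin d)) c)
      ≤ volume.real ({u | x + h • u ∈ A} ∩ Metric.ball 0 c) := by
  have h1 := ENNReal.toReal_mono (measure_ne_top_of_subset Set.inter_subset_right
    measure_ball_lt_top.ne) (hreg x hx (h * c) (by positivity) hr)
  rw [ENNReal.toReal_mul, ENNReal.toReal_ofReal hc₀.le] at h1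
  change c₀ * volume.real (Metric.ball x (h * c)) ≤ volume.real (A ∩ Metric.ball x (h * c)) at h1
  have h2 := measureReal_inter_ball (d := d) MeasurableSet.univ x hh c
  simp only [Set.univ_inter, Set.mem_univ, Set.ofPred_true] at h2
  rw [h2, measureReal_inter_ball hA x hh] at h1
  have hd0 : 0 < h ^ d := by positivity
  refine le_of_mul_le_mul_left ?_ hd0
  linarith

/-- If the entries of the truncated design matrix are close to their means, then the weighted
design form is bounded below. -/
theorem sum_polyVal_sq_mul_kernel_ge (hc : 0 < c) (hK : IsAdmissibleKernel β c K) {ι : Type*}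
    (I : Finset ι) (u : ι → EuclideanSpace ℝ (Fin d)) (E : MonoIdx d l → MonoIdx d l → ℝ)
    {ε κ : ℝ} (hE : ∀ s t, |∑ i ∈ I, designEntry c s t (u i) - E s t| ≤ ε)
    (hκ : ∀ w : MonoIdx d l → ℝ, κ * ∑ s, w s ^ 2 ≤ ∑ s, ∑ t, w s * w t * E s t)
    (w : MonoIdx d l → ℝ) :
    c * (κ - ε * Fintype.card (MonoIdx d l)) * ∑ s, w s ^ 2
      ≤ ∑ i ∈ I, polyVal w (u i) ^ 2 * K (u i) := by
  have hε : 0 ≤ ε := (abs_nonneg _).trans (hE ⟨0, by simp⟩ ⟨0, by simp⟩)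
  have h1 : c * ∑ i ∈ I, ∑ s, ∑ t, w s * w t * designEntry c s t (u i)
      ≤ ∑ i ∈ I, polyVal w (u i) ^ 2 * K (u i) := by
    rw [Finset.mul_sum]
    refine Finset.sum_le_sum fun i _ => ?_
    rw [sum_sum_mul_designEntry]
    by_cases hi : u i ∈ Metric.ball (0 : EuclideanSpace ℝ (Fin d)) c
    · rw [Set.indicator_of_mem hi, mul_comm]
      exact mul_le_mul_of_nonneg_left (hK.le_of_mem_ball hi) (sq_nonneg _)
    · rw [Set.indicator_of_notMem hi, mul_zero]
      exact mul_nonneg (sq_nonneg _) (hK.nonneg hc _)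
  have h2 : ∑ i ∈ I, ∑ s, ∑ t, w s * w t * designEntry c s t (u i)
      = ∑ s, ∑ t, w s * w t * ∑ i ∈ I, designEntry c s t (u i) := by
    rw [Finset.sum_comm]
    refine Finset.sum_congr rfl fun s _ => ?_
    rw [Finset.sum_comm]
    exact Finset.sum_congr rfl fun t _ => (Finset.mul_sum _ _ _).symm
  have h3 : ∑ s, ∑ t, w s * w t * E s t - ε * (∑ s, |w s|) ^ 2
      ≤ ∑ s, ∑ t, w s * w t * ∑ i ∈ I, designEntry c s t (u i) := by
    rw [sq, Finset.sum_mul_sum, Finset.mul_sum, ← Finset.sum_sub_distrib]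
    refine Finset.sum_le_sum fun s _ => ?_
    rw [Finset.mul_sum, ← Finset.sum_sub_distrib]
    refine Finset.sum_le_sum fun t _ => ?_
    have h4 : |w s * w t * (∑ i ∈ I, designEntry c s t (u i) - E s t)|
        ≤ ε * (|w s| * |w t|) := by
      rw [abs_mul, abs_mul, mul_comm]
      exact mul_le_mul_of_nonneg_right (hE s t) (by positivity)
    have h5 := (abs_le.1 h4).1
    rw [mul_sub] at h5
    linarith
  have h6 : (∑ s, |w s|) ^ 2 ≤ Fintype.card (MonoIdx d l) * ∑ s, w s ^ 2 := by
    have := sq_sum_le_card_mul_sum_sq (s := Finset.univ) (f := fun s => |w s|)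
    simpa [sq_abs] using this
  have h7 := mul_le_mul_of_nonneg_left h6 hε
  refine le_trans ?_ h1
  rw [h2, mul_assoc]
  refine mul_le_mul_of_nonneg_left (le_trans ?_ h3) hc.le
  linarith [hκ w]

/-- The local design is nondegenerate with high probability, uniformly over the support. -/
theorem exists_design_tail (hc₀ : 0 < c₀) (hc : 0 < c) (ha : 0 < a) (hb : 0 < b)
    (hK : IsAdmissibleKernel β c K) (hA : MeasurableSet A) (hreg : IsRegularSet c₀ r₀ A)
    (hQle : Q ≤ ENNReal.ofReal b • volume) (hQge : ENNReal.ofReal a • volume.restrict A ≤ Q)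
    (hData : IsDriftingSample ρ Q ηs X Y) (l : ℕ) :
    ∃ κ μ₀ : ℝ, 0 < κ ∧ 0 < μ₀ ∧ ∀ (n : ℕ) (h : ℝ), 0 < h → h * c ≤ r₀ → ∀ x ∈ A,
      ρ.real {ω | ¬ ∀ w : MonoIdx d l → ℝ, n * h ^ d * μ₀ * ∑ s, w s ^ 2
          ≤ ∑ i ∈ Finset.range n,
            polyVal w (h⁻¹ • (X i ω - x)) ^ 2 * K (h⁻¹ • (X i ω - x))}
        ≤ 2 * (Fintype.card (MonoIdx d l)) ^ 2 * Real.exp (-κ * (n * h ^ d)) := by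
  obtain ⟨κ₀, hκ₀, hS⟩ := exists_integral_polyVal_sq_ge hc hc₀ d l
  set J : ℝ := ((Fintype.card (MonoIdx d l) : ℕ) : ℝ) with hJ
  have hJ0 : 0 < J := by
    have : Nonempty (MonoIdx d l) := ⟨⟨0, by simp⟩⟩
    rw [hJ]
    exact_mod_cast Fintype.card_pos
  -- Entrywise deviations of size `ε` cost at most half of the mean of the design form.
  set ε : ℝ := min 1 (a * κ₀ / (2 * J)) with hε
  have hε0 : 0 < ε := lt_min one_pos (by positivity)
  have hε1 : ε ≤ 1 := min_le_left _ _
  have hεJ : ε * J ≤ a * κ₀ / 2 := by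
    calc ε * J ≤ a * κ₀ / (2 * J) * J := by gcongr; exact min_le_right _ _
      _ = a * κ₀ / 2 := by field_simp
  set M : ℝ := ((1 + c) ^ l) ^ 2 with hM
  have hM0 : 0 < M := by positivity
  set V := volume.real (Metric.ball (0 : EuclideanSpace ℝ (Fin d)) c) with hV
  have hV0 : 0 < V := ENNReal.toReal_pos (Metric.measure_ball_pos _ _ hc).ne'
    measure_ball_lt_top.ne
  have hv0 : 0 < b * (V * M ^ 2) := by positivity
  have : IsProbabilityMeasure Q := by
    rw [← hData.law_X 0]
    exact Measure.isProbabilityMeasure_map (hData.measurable_X 0).aemeasurable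
  refine ⟨min M⁻¹ (2 * (b * (V * M ^ 2)))⁻¹ / 2 * ε ^ 2, c * (a * κ₀ / 2), by positivity,
    by positivity, ?_⟩
  intro n h hh hr x hx
  have hu : Measurable fun x' : EuclideanSpace ℝ (Fin d) => h⁻¹ • (x' - x) := by fun_prop
  set ζ : MonoIdx d l → MonoIdx d l → ℕ → Ω → ℝ :=
    fun s t i ω => designEntry c s t (h⁻¹ • (X i ω - x)) with hζ
  have hζm : ∀ s t i, Measurable (ζ s t i) := fun s t i =>
    ((measurable_designEntry c s t).comp hu).comp (hData.measurable_X i)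
  have hζind : ∀ s t, iIndepFun (ζ s t) ρ := fun s t =>
    hData.indep.comp (fun _ p => designEntry c s t (h⁻¹ • (p.1 - x))) fun _ =>
      ((measurable_designEntry c s t).comp hu).comp measurable_fst
  have hζM : ∀ s t i, ∀ᵐ ω ∂ρ, |ζ s t i ω| ≤ M := fun s t i =>
    Eventually.of_forall fun ω => (abs_designEntry_le hc s t _).trans
      (Set.indicator_le_self' (fun _ _ => hM0.le) _)
  have hind : Integrable ((Metric.ball (0 : EuclideanSpace ℝ (Fin d)) c).indicator
      fun _ => M ^ 2) :=
    (integrable_indicator_iff Metric.isOpen_ball.measurableSet).2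
      (integrableOn_const measure_ball_lt_top.ne)
  have hζv : ∀ s t, ∑ i ∈ Finset.range n, ∫ ω, ζ s t i ω ^ 2 ∂ρ
      ≤ b * (V * M ^ 2) * (n * h ^ d) := by
    intro s t
    have hone : ∀ i, ∫ ω, ζ s t i ω ^ 2 ∂ρ ≤ b * (h ^ d * (V * M ^ 2)) := by
      intro i
      have hsc := integrable_scaled_of_le hQle hind x hh
      calc ∫ ω, ζ s t i ω ^ 2 ∂ρ
          = ∫ x', designEntry c s t (h⁻¹ • (x' - x)) ^ 2 ∂Q := by
            rw [← hData.law_X i]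
            exact (integral_map (hData.measurable_X i).aemeasurable
              (((measurable_designEntry c s t).comp hu).pow_const 2).aestronglyMeasurable).symm
        _ ≤ ∫ x', (Metric.ball (0 : EuclideanSpace ℝ (Fin d)) c).indicator (fun _ => M ^ 2)
              (h⁻¹ • (x' - x)) ∂Q := by
            refine integral_mono_of_nonneg (Eventually.of_forall fun _ => sq_nonneg _) hsc
              (Eventually.of_forall fun x' => ?_)
            have h1 := abs_designEntry_le hc s t (h⁻¹ • (x' - x))
            simp only
            by_cases hb : h⁻¹ • (x' - x) ∈ Metric.ball (0 : EuclideanSpace ℝ (Fin d)) c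
            · rw [Set.indicator_of_mem hb] at h1 ⊢
              rw [← sq_abs]
              gcongr
            · rw [Set.indicator_of_notMem hb] at h1 ⊢
              rw [abs_nonpos_iff.1 h1]
              simp
        _ ≤ b * (h ^ d * ∫ u, (Metric.ball (0 : EuclideanSpace ℝ (Fin d)) c).indicator
              (fun _ => M ^ 2) u) :=
            integral_scaled_le hb.le hQle hind
              (fun u => Set.indicator_nonneg (fun _ _ => sq_nonneg _) u) x hh
        _ = b * (h ^ d * (V * M ^ 2)) := by
            rw [integral_indicator_const _ Metric.isOpen_ball.measurableSet, smul_eq_mul]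
    calc ∑ i ∈ Finset.range n, ∫ ω, ζ s t i ω ^ 2 ∂ρ
        ≤ ∑ _i ∈ Finset.range n, b * (h ^ d * (V * M ^ 2)) := Finset.sum_le_sum fun i _ => hone i
      _ = b * (V * M ^ 2) * (n * h ^ d) := by
          rw [Finset.sum_const, Finset.card_range, nsmul_eq_mul]
          ring
  have hmean : ∀ s t, ∑ i ∈ Finset.range n, ∫ ω, ζ s t i ω ∂ρ
      = n * ∫ x', designEntry c s t (h⁻¹ • (x' - x)) ∂Q := by
    intro s t
    have hone : ∀ i, ∫ ω, ζ s t i ω ∂ρ = ∫ x', designEntry c s t (h⁻¹ • (x' - x)) ∂Q := by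
      intro i
      rw [← hData.law_X i]
      exact (integral_map (hData.measurable_X i).aemeasurable
        ((measurable_designEntry c s t).comp hu).aestronglyMeasurable).symm
    simp only [hone, Finset.sum_const, Finset.card_range, nsmul_eq_mul]
  have hlow := sum_integral_designEntry_ge hA ha.le hh hc hQge x
    (hS _ ((hA.preimage (by fun_prop)).inter Metric.isOpen_ball.measurableSet)
      Set.inter_subset_right (hreg.measureReal_ge hA hc₀ hc hh hr hx))
  have hsub : {ω | ¬ ∀ w : MonoIdx d l → ℝ, n * h ^ d * (c * (a * κ₀ / 2)) * ∑ s, w s ^ 2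
      ≤ ∑ i ∈ Finset.range n, polyVal w (h⁻¹ • (X i ω - x)) ^ 2 * K (h⁻¹ • (X i ω - x))}
      ⊆ ⋃ st : MonoIdx d l × MonoIdx d l, {ω | n * h ^ d * ε
        ≤ |∑ i ∈ Finset.range n, ζ st.1 st.2 i ω
          - ∑ i ∈ Finset.range n, ∫ ω, ζ st.1 st.2 i ω ∂ρ|} := by
    intro ω hω
    by_contra hne
    simp only [Set.mem_iUnion, Set.mem_ofPred_eq, not_exists, not_le, Prod.forall] at hne
    refine hω fun w => ?_
    have h1 := sum_polyVal_sq_mul_kernel_ge hc hK (Finset.range n)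
      (fun i => h⁻¹ • (X i ω - x)) (fun s t => ∑ i ∈ Finset.range n, ∫ ω, ζ s t i ω ∂ρ)
      (ε := n * h ^ d * ε) (κ := n * (a * h ^ d * κ₀)) (fun s t => (hne s t).le)
      (fun w => by
        simp only [hmean]
        calc n * (a * h ^ d * κ₀) * ∑ s, w s ^ 2
            = n * (a * h ^ d * κ₀ * ∑ s, w s ^ 2) := by ring
          _ ≤ n * ∑ s, ∑ t, w s * w t * ∫ x', designEntry c s t (h⁻¹ • (x' - x)) ∂Q := by
            gcongr
            exact hlow w
          _ = _ := by
            rw [Finset.mul_sum]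
            refine Finset.sum_congr rfl fun s _ => ?_
            rw [Finset.mul_sum]
            exact Finset.sum_congr rfl fun t _ => by ring) w
    refine le_trans ?_ h1
    refine mul_le_mul_of_nonneg_right ?_ (Finset.sum_nonneg fun _ _ => sq_nonneg _)
    have h2 : n * h ^ d * ε * J ≤ n * h ^ d * (a * κ₀ / 2) := by
      rw [mul_assoc]
      gcongr
    calc n * h ^ d * (c * (a * κ₀ / 2))
        = c * (n * (a * h ^ d * κ₀) - n * h ^ d * (a * κ₀ / 2)) := by
          ring
      _ ≤ _ := by gcongr
  refine (measureReal_mono hsub).trans ((measureReal_iUnion_fintype_le _).trans ?_)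
  calc ∑ st : MonoIdx d l × MonoIdx d l, ρ.real {ω | n * h ^ d * ε
        ≤ |∑ i ∈ Finset.range n, ζ st.1 st.2 i ω
          - ∑ i ∈ Finset.range n, ∫ ω, ζ st.1 st.2 i ω ∂ρ|}
      ≤ ∑ _st : MonoIdx d l × MonoIdx d l, 2 * Real.exp
          (-(min M⁻¹ (2 * (b * (V * M ^ 2)))⁻¹ / 2) * (n * h ^ d * ε ^ 2)) :=
        Finset.sum_le_sum fun st _ => measure_abs_sum_sub_ge_le (hζm st.1 st.2)
          (hζind st.1 st.2) _ (hζM st.1 st.2) hM0 hv0 (by positivity) hε0.le hε1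
          (hζv st.1 st.2)
    _ = 2 * J ^ 2 * Real.exp
          (-(min M⁻¹ (2 * (b * (V * M ^ 2)))⁻¹ / 2 * ε ^ 2) * (n * h ^ d)) := by
        rw [Finset.sum_const, Finset.card_univ, Fintype.card_prod, nsmul_eq_mul, hJ,
          show ∀ y : ℝ, -y * (n * h ^ d * ε ^ 2) = -(y * ε ^ 2) * (n * h ^ d) from fun y => by ring]
        push_cast
        ring

end Design

/-! ### Deviations of the local polynomial estimator -/

section Tail

variable {d l m : ℕ} {Ω : Type*} [MeasurableSpace Ω] {ρ : Measure Ω} [IsProbabilityMeasure ρ]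
  {Q : Measure (EuclideanSpace ℝ (Fin d))} {X : ℕ → Ω → EuclideanSpace ℝ (Fin d)}
  {Y : ℕ → Ω → Fin m} {ηs : ℕ → Fin m → EuclideanSpace ℝ (Fin d) → ℝ}
  {η : Fin m → EuclideanSpace ℝ (Fin d) → ℝ} {K : EuclideanSpace ℝ (Fin d) → ℝ}
  {β L c a b c₀ r₀ : ℝ} {A : Set (EuclideanSpace ℝ (Fin d))}

theorem abs_clamp_sub_le {y z : ℝ} (hz : z ∈ Set.Icc (0 : ℝ) 1) :
    |max 0 (min 1 y) - z| ≤ |y - z| := by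
  have h := abs_max_sub_max_le_abs (min 1 y) z 0
  have h2 := abs_min_sub_min_le_max 1 y 1 z
  rw [max_eq_left hz.1, max_comm] at h
  rw [min_eq_right hz.2, sub_self, abs_zero, max_eq_right (abs_nonneg _)] at h2
  exact h.trans h2

theorem abs_clamp_sub_le_one (y : ℝ) {z : ℝ} (hz : z ∈ Set.Icc (0 : ℝ) 1) :
    |max 0 (min 1 y) - z| ≤ 1 := by
  have h1 : 0 ≤ max 0 (min 1 y) := le_max_left _ _
  have h2 : max 0 (min 1 y) ≤ 1 := max_le zero_le_one (min_le_left _ _)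
  exact abs_sub_le_iff.2 ⟨by linarith [hz.1], by linarith [hz.2]⟩

/-- The truncated local polynomial estimator has sub-Gaussian deviations at the scale `h ^ β`,
uniformly over the support of the law of the observations. -/
theorem exists_etaHat_tail (hd : 1 ≤ d) (hβ : 0 < β) (hl : (l : ℝ) ≤ β) (hL : 0 ≤ L)
    (hc₀ : 0 < c₀) (hc : 0 < c) (ha : 0 < a) (hb : 0 < b) (hK : IsAdmissibleKernel β c K)
    (hKmoment : Integrable fun u : EuclideanSpace ℝ (Fin d) => ‖u‖ ^ ((l : ℝ) + β) * K u)
    (hA : MeasurableSet A) (hreg : IsRegularSet c₀ r₀ A)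
    (hQle : Q ≤ ENNReal.ofReal b • volume) (hQge : ENNReal.ofReal a • volume.restrict A ≤ Q)
    (hη : ∀ j, ∀ᵐ x ∂Q, η j x ∈ Set.Icc (0 : ℝ) 1) (hHolder : ∀ j, IsHolderClass β l L (η j))
    (hData : IsDriftingSample ρ Q ηs X Y) (hDrift : HasDriftRate β ηs η) :
    ∃ C κ : ℝ, 0 < C ∧ 0 < κ ∧ ∀ n : ℕ, 0 < n → ∀ h : ℝ, h = (n : ℝ) ^ (-(1 / (2 * β + d))) →
      h * c ≤ r₀ → ∀ x ∈ A, ∀ j, η j x ∈ Set.Icc (0 : ℝ) 1 → ∀ t : ℝ, 0 ≤ t →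
      ρ.real {ω | h ^ β * t ≤ |etaHat K h l (fun i : Fin n => (X i ω, Y i ω)) j x - η j x|}
        ≤ C * Real.exp (-κ * t ^ 2) := by
  obtain ⟨κ₁, B, hκ₁, hB, hres⟩ :=
    exists_lpResidual_tail hd hβ hl hL hc hb hK hKmoment hQle hη hData hDrift
  obtain ⟨κ₂, μ₀, hκ₂, hμ₀, hdes⟩ :=
    exists_design_tail hc₀ hc ha hb hK hA hreg hQle hQge hData l
  set J : ℝ := ((Fintype.card (MonoIdx d l) : ℕ) : ℝ) with hJ
  have hJ0 : 0 < J := by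
    have : Nonempty (MonoIdx d l) := ⟨⟨0, by simp⟩⟩
    rw [hJ]
    exact_mod_cast Fintype.card_pos
  -- `q * δ` is the size of the residual moments that forces an error below `δ`; a third of it is
  -- left for the deviation and a third for the bias.
  set q : ℝ := μ₀ / J with hq
  have hq0 : 0 < q := by positivity
  set p : ℝ := min 1 (q / 3) with hp
  have hp0 : 0 < p := lt_min one_pos (by positivity)
  have hp1 : p ≤ 1 := min_le_left _ _
  have hpq : p ≤ q / 3 := min_le_right _ _
  set T : ℝ := 3 * B / q with hT
  have hT0 : 0 < T := by positivity
  set κ : ℝ := min (κ₁ * p ^ 2) κ₂ with hκ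
  have hκ0 : 0 < κ := lt_min (by positivity) hκ₂
  have hC0 : 0 < 2 * J + 2 * J ^ 2 + Real.exp (κ * T ^ 2) := by positivity
  refine ⟨2 * J + 2 * J ^ 2 + Real.exp (κ * T ^ 2), κ, hC0, hκ0, ?_⟩
  intro n hn h hh hr x hx j hj t ht
  have hh0 : 0 < h := bandwidth_pos hn hh
  have hhβ : 0 < h ^ β := Real.rpow_pos_of_pos hh0 β
  have hn' : (0 : ℝ) < n := by exact_mod_cast hn
  set N : ℝ := n * h ^ d with hN
  have hN0 : 0 < N := by positivity
  have hN1 : N * (h ^ β) ^ 2 = 1 := effective_size_mul_sq hβ hn hh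
  -- Below the threshold `T` the bias is not dominated by `t`; there the constant makes the bound
  -- trivial.
  rcases lt_or_ge t T with htT | htT
  · refine (measureReal_le_one (μ := ρ)).trans ?_
    calc (1 : ℝ) = Real.exp (κ * T ^ 2) * Real.exp (-κ * T ^ 2) := by
          rw [← Real.exp_add, neg_mul, add_neg_cancel, Real.exp_zero]
      _ ≤ Real.exp (κ * T ^ 2) * Real.exp (-κ * t ^ 2) := by
          refine mul_le_mul_of_nonneg_left (Real.exp_le_exp.2 ?_) (Real.exp_pos _).le
          have : κ * t ^ 2 ≤ κ * T ^ 2 := by gcongr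
          linarith
      _ ≤ _ := by
          refine mul_le_mul_of_nonneg_right ?_ (Real.exp_pos _).le
          have : 0 < 2 * J + 2 * J ^ 2 := by positivity
          linarith
  have ht0 : 0 < t := hT0.trans_le htT
  -- Errors above `1` are impossible, since the estimator is truncated.
  rcases lt_or_ge 1 (h ^ β * t) with hδ1 | hδ1
  · have hempty : {ω | h ^ β * t
        ≤ |etaHat K h l (fun i : Fin n => (X i ω, Y i ω)) j x - η j x|} = ∅ := by
      ext ω
      simp only [Set.mem_ofPred_eq, Set.mem_empty_iff_false, iff_false, not_le]
      exact (abs_clamp_sub_le_one _ hj).trans_lt hδ1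
    rw [hempty, measureReal_empty]
    positivity
  -- Only `δ ≤ 1` is left, the range of the Bernstein bounds.
  set δ : ℝ := h ^ β * t with hδ
  have hδ0 : 0 < δ := by positivity
  have hNδ : N * δ ^ 2 = t ^ 2 := by
    rw [hδ, mul_pow, ← mul_assoc, hN1, one_mul]
  have hbias : B * h ^ β ≤ q / 3 * δ := by
    have : B ≤ q / 3 * t := by
      have := mul_le_mul_of_nonneg_left htT (by positivity : 0 ≤ q / 3)
      rw [hT] at this
      calc B = q / 3 * (3 * B / q) := by field_simp
        _ ≤ _ := this
    calc B * h ^ β ≤ q / 3 * t * h ^ β := by gcongr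
      _ = q / 3 * δ := by rw [hδ]; ring
  obtain ⟨w, hw, hw0⟩ := (hHolder j).exists_approx hβ hh0 x
  have hsub : {ω | δ ≤ |etaHat K h l (fun i : Fin n => (X i ω, Y i ω)) j x - η j x|}
      ⊆ (⋃ s : MonoIdx d l, {ω | N * (p * δ + B * h ^ β)
          ≤ |∑ i ∈ Finset.range n, lpResidual K h j x w s (X i ω, Y i ω)|})
        ∪ {ω | ¬ ∀ w : MonoIdx d l → ℝ, N * μ₀ * ∑ s, w s ^ 2
          ≤ ∑ i ∈ Finset.range n,
            polyVal w (h⁻¹ • (X i ω - x)) ^ 2 * K (h⁻¹ • (X i ω - x))} := by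
    intro ω hω
    by_contra hne
    rw [Set.mem_union, not_or] at hne
    obtain ⟨h1, h2⟩ := hne
    simp only [Set.mem_iUnion, Set.mem_ofPred_eq, not_exists, not_le] at h1
    have h2' : ∀ w : MonoIdx d l → ℝ, N * μ₀ * ∑ s, w s ^ 2 ≤ ∑ i ∈ Finset.range n,
        polyVal w (h⁻¹ • (X i ω - x)) ^ 2 * K (h⁻¹ • (X i ω - x)) := not_not.1 h2
    have h3 := abs_lpEstimator_sub_le (K := K) hh0.ne' (j := j) (x := x) (l := l)
      (z := fun i : Fin n => (X i ω, Y i ω)) (δ := p * δ + B * h ^ β) hN0 hμ₀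
      (fun v => by
        rw [Fin.sum_univ_eq_sum_range
          (fun i => polyVal v (h⁻¹ • (X i ω - x)) ^ 2 * K (h⁻¹ • (X i ω - x))) n]
        exact h2' v) w
      (fun s => by
        have h4 := (h1 s).le
        rw [← Fin.sum_univ_eq_sum_range (fun i => lpResidual K h j x w s (X i ω, Y i ω)) n] at h4
        exact h4)
    rw [hw0] at h3
    have h5 : J * (p * δ + B * h ^ β) / μ₀ < δ := by
      rw [div_lt_iff₀ hμ₀]
      have hqJ : q * J = μ₀ := by rw [hq]; field_simp
      calc J * (p * δ + B * h ^ β) ≤ J * (q / 3 * δ + q / 3 * δ) := by gcongr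
        _ = δ * μ₀ * (2 / 3) := by rw [← hqJ]; ring
        _ < δ * μ₀ := by linarith [mul_pos hδ0 hμ₀]
    exact absurd (lt_of_le_of_lt ((abs_clamp_sub_le hj).trans h3) h5) (not_lt.2 hω)
  refine (measureReal_mono hsub).trans ((measureReal_union_le _ _).trans ?_)
  have hpδ1 : p * δ ≤ 1 := mul_le_one₀ hp1 hδ0.le hδ1
  have e1 : ρ.real (⋃ s : MonoIdx d l, {ω | N * (p * δ + B * h ^ β)
      ≤ |∑ i ∈ Finset.range n, lpResidual K h j x w s (X i ω, Y i ω)|})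
      ≤ 2 * J * Real.exp (-κ * t ^ 2) := by
    refine (measureReal_iUnion_fintype_le _).trans ?_
    refine (Finset.sum_le_sum fun s _ =>
      hres n hn h hh x j w hw s (p * δ) (by positivity) hpδ1).trans ?_
    rw [Finset.sum_const, Finset.card_univ, nsmul_eq_mul, ← hJ, ← mul_assoc, mul_comm J 2]
    refine mul_le_mul_of_nonneg_left (Real.exp_le_exp.2 ?_) (by positivity)
    rw [← hN, mul_pow, show N * (p ^ 2 * δ ^ 2) = p ^ 2 * (N * δ ^ 2) by ring, hNδ, ← mul_assoc]
    refine mul_le_mul_of_nonneg_right ?_ (sq_nonneg t)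
    have : κ ≤ κ₁ * p ^ 2 := min_le_left _ _
    linarith
  have e2 : ρ.real {ω | ¬ ∀ w : MonoIdx d l → ℝ, N * μ₀ * ∑ s, w s ^ 2
      ≤ ∑ i ∈ Finset.range n, polyVal w (h⁻¹ • (X i ω - x)) ^ 2 * K (h⁻¹ • (X i ω - x))}
      ≤ 2 * J ^ 2 * Real.exp (-κ * t ^ 2) := by
    refine (hdes n h hh0 hr x hx).trans ?_
    refine mul_le_mul_of_nonneg_left (Real.exp_le_exp.2 ?_) (by positivity)
    have h1 : t ^ 2 ≤ N := by
      rw [← hNδ]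
      exact mul_le_of_le_one_right hN0.le (pow_le_one₀ hδ0.le hδ1)
    have h2 : κ ≤ κ₂ := min_le_right _ _
    have h3 : κ * t ^ 2 ≤ κ₂ * N := mul_le_mul h2 h1 (sq_nonneg t) hκ₂.le
    linarith
  have h6 : 0 < Real.exp (κ * T ^ 2) * Real.exp (-κ * t ^ 2) := by positivity
  linarith

end Tail

/-! ### The strong density assumption -/

section Density

variable {d : ℕ} {μmin μmax : ℝ} {A : Set (EuclideanSpace ℝ (Fin d))}
  {μ : EuclideanSpace ℝ (Fin d) → ℝ}

theorem withDensity_le_smul_volume (h0 : 0 ≤ μmax) (hA : ∀ x ∈ A, μ x ≤ μmax)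
    (hAc : ∀ x ∉ A, μ x = 0) :
    volume.withDensity (fun x => ENNReal.ofReal (μ x)) ≤ ENNReal.ofReal μmax • volume := by
  rw [← withDensity_const]
  refine withDensity_mono (Eventually.of_forall fun x => ENNReal.ofReal_le_ofReal ?_)
  by_cases hx : x ∈ A
  · exact hA x hx
  · rw [hAc x hx]
    exact h0

theorem smul_restrict_le_withDensity (hAm : MeasurableSet A) (hA : ∀ x ∈ A, μmin ≤ μ x) :
    ENNReal.ofReal μmin • volume.restrict A
      ≤ volume.withDensity (fun x => ENNReal.ofReal (μ x)) := by
  rw [← withDensity_const, ← withDensity_indicator hAm]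
  refine withDensity_mono (Eventually.of_forall fun x => ?_)
  by_cases hx : x ∈ A
  · simpa [Set.indicator_of_mem hx] using ENNReal.ofReal_le_ofReal (hA x hx)
  · simp [Set.indicator_of_notMem hx]

theorem ae_mem_withDensity (hAm : MeasurableSet A) (hAc : ∀ x ∉ A, μ x = 0) :
    ∀ᵐ x ∂(volume.withDensity (fun x => ENNReal.ofReal (μ x))), x ∈ A := by
  rw [ae_iff]
  change volume.withDensity (fun x => ENNReal.ofReal (μ x)) Aᶜ = 0
  rw [withDensity_apply _ hAm.compl, setLIntegral_congr_fun (g := fun _ => 0) hAm.compl]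
  · simp
  · intro x hx
    simp [hAc x hx]

end Density

/-! ### Excess risk and margin -/

section Risk

variable {d m : ℕ} {P : Measure (EuclideanSpace ℝ (Fin d) × Fin m)} [IsProbabilityMeasure P]
  {η : Fin m → EuclideanSpace ℝ (Fin d) → ℝ}

/-- The risk is `1 - 𝔼 η_{f(X)}(X)`. -/
theorem risk_eq (hη : IsLabelProb P Prod.fst Prod.snd η) (hηm : ∀ j, Measurable (η j))
    {f : EuclideanSpace ℝ (Fin d) → Fin m} (hf : Measurable f) :
    Integrable (fun x => η (f x) x) (P.map Prod.fst) ∧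
      risk P f = 1 - ∫ x, η (f x) x ∂(P.map Prod.fst) := by
  have h01 : ∀ᵐ z ∂P, ∀ j, η j z.1 ∈ Set.Icc (0 : ℝ) 1 :=
    ae_all_iff.2 fun j => hη.ae_mem_Icc measurable_snd j
  have hηf : Measurable fun x => η (f x) x :=
    (measurable_from_prod_countable_left (f := fun p : EuclideanSpace ℝ (Fin d) × Fin m =>
      η p.2 p.1) hηm).comp (measurable_id.prodMk hf)
  have hintP : Integrable (fun z : EuclideanSpace ℝ (Fin d) × Fin m => η (f z.1) z.1) P := by
    refine Integrable.of_bound (hηf.comp measurable_fst).aestronglyMeasurable 1 ?_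
    filter_upwards [h01] with z hz
    rw [Real.norm_eq_abs, abs_of_nonneg (hz _).1]
    exact (hz _).2
  have hmap : ∫ x, η (f x) x ∂(P.map Prod.fst) = ∫ z, η (f z.1) z.1 ∂P :=
    integral_map measurable_fst.aemeasurable hηf.aestronglyMeasurable
  refine ⟨(integrable_map_measure hηf.aestronglyMeasurable measurable_fst.aemeasurable).2 hintP,
    ?_⟩
  have hmeas : MeasurableSet {z : EuclideanSpace ℝ (Fin d) × Fin m | z.2 = f z.1} :=
    measurableSet_eq_fun measurable_snd (hf.comp measurable_fst)
  have hrisk : risk P f = 1 - P.real {z | z.2 = f z.1} := by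
    rw [risk, ← probReal_compl_eq_one_sub hmeas]
    rfl
  rw [hrisk, hmap, ← integral_indicator_one hmeas]
  congr 1
  set φ : Fin m → EuclideanSpace ℝ (Fin d) → ℝ := fun j x => if f x = j then 1 else 0 with hφ
  have hφm : ∀ j, Measurable (φ j) := fun j => measurable_labelIndicator hf j
  have hφ1 : ∀ j x, |φ j x| ≤ 1 := fun j x => by
    rw [hφ]
    dsimp only
    split_ifs <;> simp
  have e1 : ∀ z : EuclideanSpace ℝ (Fin d) × Fin m, {z | z.2 = f z.1}.indicator
      (1 : EuclideanSpace ℝ (Fin d) × Fin m → ℝ) z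
      = ∑ j, (if z.2 = j then (1 : ℝ) else 0) * φ j z.1 := by
    intro z
    simp only [ite_mul, one_mul, zero_mul, Finset.sum_ite_eq, Finset.mem_univ, if_true, hφ]
    by_cases hz : z.2 = f z.1
    · rw [Set.indicator_of_mem (by exact hz), if_pos hz.symm]
      rfl
    · rw [Set.indicator_of_notMem (by exact hz), if_neg fun h => hz h.symm]
  have e2 : ∀ z : EuclideanSpace ℝ (Fin d) × Fin m, η (f z.1) z.1 = ∑ j, η j z.1 * φ j z.1 := by
    intro z
    simp [hφ]
  have hi1 : ∀ j, Integrable (fun z : EuclideanSpace ℝ (Fin d) × Fin m =>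
      (if z.2 = j then (1 : ℝ) else 0) * φ j z.1) P := fun j => by
    refine Integrable.of_bound ((measurable_labelIndicator measurable_snd j).mul
      ((hφm j).comp measurable_fst)).aestronglyMeasurable 1 (Eventually.of_forall fun z => ?_)
    split_ifs
    · simpa using hφ1 j z.1
    · simp
  have hi2 : ∀ j, Integrable (fun z : EuclideanSpace ℝ (Fin d) × Fin m =>
      η j z.1 * φ j z.1) P := fun j => by
    refine Integrable.of_bound (((hηm j).comp measurable_fst).mul
      ((hφm j).comp measurable_fst)).aestronglyMeasurable 1 ?_
    filter_upwards [h01] with z hz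
    rw [Real.norm_eq_abs, abs_mul]
    exact mul_le_one₀ (by rw [abs_of_nonneg (hz j).1]; exact (hz j).2) (abs_nonneg _) (hφ1 j z.1)
  simp only [e1, e2]
  rw [integral_finsetSum _ fun j _ => hi1 j, integral_finsetSum _ fun j _ => hi2 j]
  refine Finset.sum_congr rfl fun j _ => ?_
  rw [integral_labelIndicator_mul_eq measurable_fst measurable_snd j (hφm j) (hφ1 j)]
  refine integral_congr_ae ?_
  filter_upwards [hη j] with z hz
  rw [hz]

/-- The gap between the two largest entries is at most the distance of the maximum to any entry
that is strictly smaller. -/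
theorem kthLargest_sub_le {hm : 2 ≤ m} (v : Fin m → ℝ) {i j : Fin m} (hi : ∀ k, v k ≤ v i)
    (hij : v j < v i) :
    kthLargest v ⟨0, by omega⟩ - kthLargest v ⟨1, by omega⟩ ≤ v i - v j := by
  have hmono := Tuple.monotone_sort v
  have h0 : kthLargest v ⟨0, by omega⟩ ≤ v i := hi _
  suffices h1 : v j ≤ kthLargest v ⟨1, by omega⟩ by linarith
  set k := (Tuple.sort v).symm j with hk
  have hjk : v j = (v ∘ Tuple.sort v) k := by simp [hk]
  have hlt : k.1 < ((Tuple.sort v).symm i).1 := by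
    by_contra hle
    have h2 := hmono (a := (Tuple.sort v).symm i) (b := k) (not_lt.1 hle)
    rw [← hjk] at h2
    simp only [Function.comp_apply, Equiv.apply_symm_apply] at h2
    linarith
  rw [hjk]
  refine hmono ?_
  rw [Fin.le_def, Fin.val_rev]
  have := ((Tuple.sort v).symm i).2
  simp only
  omega

/-- A loss that is at least the gap wherever it is positive, integrated over the layers
`[2 * ε * k, 2 * ε * (k + 1))` of its values. -/
theorem lintegral_loss_le {Ω E : Type*} [MeasurableSpace Ω] [MeasurableSpace E]
    {ρ : Measure Ω} [IsProbabilityMeasure ρ] {Q : Measure E} [IsProbabilityMeasure Q]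
    {loss : Ω → E → ℝ} (hmeas : Measurable (Function.uncurry loss)) {ε : ℝ} (hε : 0 < ε)
    {gap : E → ℝ} {p : ℕ → ℝ} {C₀ α : ℝ}
    (hp : ∀ᵐ x ∂Q, ∀ k : ℕ, ρ.real {ω | 2 * ε * k ≤ loss ω x} ≤ p k)
    (hgap : ∀ ω x, 0 < loss ω x → gap x ≤ loss ω x)
    (hQ : ∀ t : ℝ, 0 < t → Q {x | gap x ≤ t} ≤ ENNReal.ofReal (C₀ * t ^ α)) :
    ∫⁻ ω, ∫⁻ x, ENNReal.ofReal (loss ω x) ∂Q ∂ρ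
      ≤ ∑' k : ℕ, ENNReal.ofReal (2 * ε * (k + 1))
        * ENNReal.ofReal (C₀ * (2 * ε * (k + 1)) ^ α) * ENNReal.ofReal (p k) := by
  -- `gap` need not be measurable, so its sublevel sets are replaced by measurable hulls.
  set S : ℕ → Set E := fun k => toMeasurable Q {x | gap x ≤ 2 * ε * (k + 1)} with hS
  rw [lintegral_lintegral_swap (f := fun ω x => ENNReal.ofReal (loss ω x))
    hmeas.ennreal_ofReal.aemeasurable]
  have hx : ∀ x, Measurable fun ω => loss ω x := fun x => hmeas.comp measurable_prodMk_right
  have hpt : ∀ x ω, ENNReal.ofReal (loss ω x) ≤ ∑' k : ℕ, ENNReal.ofReal (2 * ε * (k + 1))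
      * (S k).indicator 1 x * {ω | 2 * ε * k ≤ loss ω x}.indicator 1 ω := by
    intro x ω
    rcases le_or_gt (loss ω x) 0 with h0 | h0
    · rw [ENNReal.ofReal_of_nonpos h0]
      exact zero_le
    · set k := ⌊loss ω x / (2 * ε)⌋₊ with hk
      have h1 : 2 * ε * k ≤ loss ω x := by
        have := Nat.floor_le (div_nonneg h0.le (by positivity : 0 ≤ 2 * ε))
        rw [le_div_iff₀ (by positivity)] at this
        linarith
      have h2 : loss ω x ≤ 2 * ε * (k + 1) := by
        have := (Nat.lt_floor_add_one (loss ω x / (2 * ε))).le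
        rw [div_le_iff₀ (by positivity)] at this
        linarith
      refine le_trans ?_ (ENNReal.le_tsum k)
      rw [Set.indicator_of_mem (show x ∈ S k from
        subset_toMeasurable _ _ ((hgap ω x h0).trans h2)), Set.indicator_of_mem (by exact h1)]
      simpa using ENNReal.ofReal_le_ofReal h2
  have hω : ∀ᵐ x ∂Q, ∫⁻ ω, ENNReal.ofReal (loss ω x) ∂ρ
      ≤ ∑' k : ℕ, ENNReal.ofReal (2 * ε * (k + 1)) * ENNReal.ofReal (p k)
        * (S k).indicator 1 x := by
    filter_upwards [hp] with x hpx
    have hset : ∀ k : ℕ, MeasurableSet {ω | 2 * ε * k ≤ loss ω x} := fun k =>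
      measurableSet_le measurable_const (hx x)
    refine (lintegral_mono (hpt x)).trans ?_
    rw [lintegral_tsum fun k => ((measurable_one.indicator (hset k)).const_mul _).aemeasurable]
    refine ENNReal.tsum_le_tsum fun k => ?_
    rw [lintegral_const_mul _ (measurable_one.indicator (hset k)), lintegral_indicator_one (hset k),
      mul_right_comm]
    refine mul_le_mul_left (mul_le_mul_right ?_ _) _
    rw [← ofReal_measureReal]
    exact ENNReal.ofReal_le_ofReal (hpx k)
  have hSm : ∀ k, MeasurableSet (S k) := fun k => measurableSet_toMeasurable _ _
  refine (lintegral_mono_ae hω).trans ?_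
  rw [lintegral_tsum fun k => ((measurable_one.indicator (hSm k)).const_mul _).aemeasurable]
  refine ENNReal.tsum_le_tsum fun k => ?_
  rw [lintegral_const_mul _ (measurable_one.indicator (hSm k)), lintegral_indicator_one (hSm k),
    measure_toMeasurable, mul_right_comm]
  exact mul_le_mul_left (mul_le_mul_right (hQ _ (by positivity)) _) _

theorem summable_rpow_mul_exp_neg_sq (a : ℝ) {κ : ℝ} (hκ : 0 < κ) :
    Summable fun k : ℕ => ((k : ℝ) + 1) ^ a * Real.exp (-κ * (k : ℝ) ^ 2) := by
  have h1 := (summable_nat_add_iff 1).2 (Real.summable_pow_mul_exp_neg_nat_mul ⌈a⌉₊ hκ)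
  refine Summable.of_nonneg_of_le (fun k => by positivity) (fun k => ?_)
    (h1.mul_left (Real.exp κ))
  have h2 : ((k : ℝ) + 1) ^ a ≤ ((k : ℝ) + 1) ^ ⌈a⌉₊ := by
    rw [← Real.rpow_natCast]
    exact Real.rpow_le_rpow_of_exponent_le (by linarith [(Nat.cast_nonneg k : (0 : ℝ) ≤ k)])
      (Nat.le_ceil a)
  have h3 : (k : ℝ) ≤ (k : ℝ) ^ 2 := by exact_mod_cast Nat.le_self_pow two_ne_zero k
  have h4 : Real.exp (-κ * (k : ℝ) ^ 2) ≤ Real.exp κ * Real.exp (-κ * ((k + 1 : ℕ) : ℝ)) := by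
    rw [← Real.exp_add]
    refine Real.exp_le_exp.2 ?_
    push_cast
    nlinarith
  calc ((k : ℝ) + 1) ^ a * Real.exp (-κ * (k : ℝ) ^ 2)
      ≤ ((k : ℝ) + 1) ^ ⌈a⌉₊ * (Real.exp κ * Real.exp (-κ * ((k + 1 : ℕ) : ℝ))) := by gcongr
    _ = _ := by
      push_cast
      ring

end Risk

end

/-! ### The rate of convergence -/

theorem theorem2 {d m : ℕ} (hd : 1 ≤ d) (hm : 2 ≤ m)
    -- smoothness `β`; `l` is its integer part, in either convention if `β` is an integer
    (β : ℝ) (hβ : 0 < β) (l : ℕ) (hl : l = ⌊β⌋₊ ∨ l + 1 = ⌈β⌉₊)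
    (L : ℝ) (hL : 0 < L)
    (c₀ r₀ μmin μmax : ℝ) (hc₀ : 0 < c₀) (hr₀ : 0 < r₀) (hμmin : 0 < μmin) (hμ : μmin < μmax)
    (𝒞 : Set (EuclideanSpace ℝ (Fin d))) (h𝒞 : IsCompact 𝒞)
    (C₀ α : ℝ) (hC₀ : 0 < C₀) (hα : 0 ≤ α)
    -- the kernel
    (K : EuclideanSpace ℝ (Fin d) → ℝ) (c : ℝ) (hc : 0 < c) (hK : IsAdmissibleKernel β c K)
    (hKmoment : Integrable fun u : EuclideanSpace ℝ (Fin d) => ‖u‖ ^ ((l : ℝ) + β) * K u)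
    -- the test distribution and its conditional label probabilities
    (P : Measure (EuclideanSpace ℝ (Fin d) × Fin m)) [IsProbabilityMeasure P]
    (η : Fin m → EuclideanSpace ℝ (Fin d) → ℝ)
    (hη : IsLabelProb P Prod.fst Prod.snd η)
    (hHolder : ∀ j, IsHolderClass β l L (η j))
    (hDensity : StrongDensity c₀ r₀ μmin μmax 𝒞 (P.map Prod.fst))
    (hMargin : MarginAssumption hm C₀ α (P.map Prod.fst) η)
    -- the training data
    {Ω : Type*} [MeasurableSpace Ω] (ρ : Measure Ω) [IsProbabilityMeasure ρ]
    (X : ℕ → Ω → EuclideanSpace ℝ (Fin d)) (Y : ℕ → Ω → Fin m)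
    (ηs : ℕ → Fin m → EuclideanSpace ℝ (Fin d) → ℝ)
    (hData : IsDriftingSample ρ (P.map Prod.fst) ηs X Y)
    (hDrift : HasDriftRate β ηs η)
    -- the plug-in classifiers and the Bayes classifier
    (f : (n : ℕ) → (Fin n → EuclideanSpace ℝ (Fin d) × Fin m) →
      EuclideanSpace ℝ (Fin d) → Fin m)
    (hf : ∀ n : ℕ, IsPlugInClassifier K ((n : ℝ) ^ (-(1 / (2 * β + d)))) l (f n))
    (fstar : EuclideanSpace ℝ (Fin d) → Fin m) (hfstar : IsBayesClassifier η fstar) :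
    ∃ C : ℝ, 0 < C ∧ ∀ n : ℕ, 0 < n → (n : ℝ) ^ (-(1 / (2 * β + d))) ≤ r₀ / c →
      excessRisk ρ P X Y (f n) fstar ≤ C * (n : ℝ) ^ (-(β * (1 + α) / (2 * β + d))) := by
  have hlβ : (l : ℝ) ≤ β := by
    rcases hl with rfl | hl
    · exact Nat.floor_le hβ.le
    · exact (Nat.lt_ceil.1 (by omega)).le
  set Q := P.map Prod.fst
  have hQprob : IsProbabilityMeasure Q :=
    Measure.isProbabilityMeasure_map measurable_fst.aemeasurable
  obtain ⟨A, μ, hAc, -, hreg, -, hQ, hμA, hμAc⟩ := hDensity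
  have hAm : MeasurableSet A := hAc.measurableSet
  have hμmax : 0 < μmax := hμmin.trans hμ
  have hQle : Q ≤ ENNReal.ofReal μmax • volume := by
    rw [hQ]
    exact withDensity_le_smul_volume hμmax.le (fun x hx => (hμA x hx).2) hμAc
  have hQge : ENNReal.ofReal μmin • volume.restrict A ≤ Q := by
    rw [hQ]
    exact smul_restrict_le_withDensity hAm fun x hx => (hμA x hx).1
  have hQA : ∀ᵐ x ∂Q, x ∈ A := by
    rw [hQ]
    exact ae_mem_withDensity hAm hμAc
  have hηm : ∀ j, Measurable (η j) := fun j => (hHolder j).1.continuous.measurable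
  have hη01 : ∀ j, ∀ᵐ x ∂Q, η j x ∈ Set.Icc (0 : ℝ) 1 := fun j =>
    (ae_map_iff measurable_fst.aemeasurable ((hηm j) measurableSet_Icc)).2
      (hη.ae_mem_Icc measurable_snd j)
  have hη01' : ∀ᵐ x ∂Q, ∀ j, η j x ∈ Set.Icc (0 : ℝ) 1 := ae_all_iff.2 hη01
  obtain ⟨C, κ, hC, hκ, htail⟩ := exists_etaHat_tail hd hβ hlβ hL.le hc₀ hc hμmin hμmax hK
    hKmoment hAm hreg hQle hQge hη01 hHolder hData hDrift
  set S : ℕ → ℝ := fun k => 2 * (C₀ * 2 ^ α) * (m * C)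
    * (((k : ℝ) + 1) ^ (1 + α) * Real.exp (-κ * (k : ℝ) ^ 2)) with hS
  have hSsum : Summable S := (summable_rpow_mul_exp_neg_sq (1 + α) hκ).mul_left _
  have hS0 : ∀ k, 0 ≤ S k := fun k => by positivity
  refine ⟨1 + ∑' k, S k, add_pos_of_pos_of_nonneg one_pos (tsum_nonneg hS0), ?_⟩
  intro n hn hnr
  set h : ℝ := (n : ℝ) ^ (-(1 / (2 * β + d))) with hh
  have hh0 : 0 < h := bandwidth_pos hn hh
  have hr : h * c ≤ r₀ := (le_div_iff₀ hc).1 hnr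
  set ε : ℝ := h ^ β with hε
  have hε0 : 0 < ε := Real.rpow_pos_of_pos hh0 β
  set Z : Ω → Fin n → EuclideanSpace ℝ (Fin d) × Fin m := fun ω i => (X i ω, Y i ω) with hZ
  have hZm : Measurable Z := measurable_pi_lambda _ fun i =>
    (hData.measurable_X i).prodMk (hData.measurable_Y i)
  set loss : Ω → EuclideanSpace ℝ (Fin d) → ℝ :=
    fun ω x => η (fstar x) x - η (f n (Z ω) x) x with hloss
  have hpair : Measurable fun p : EuclideanSpace ℝ (Fin d) × Fin m => η p.2 p.1 :=
    measurable_from_prod_countable_left hηm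
  have hfm : Measurable fun p : Ω × EuclideanSpace ℝ (Fin d) => f n (Z p.1) p.2 :=
    (hf n).1.comp ((hZm.comp measurable_fst).prodMk measurable_snd)
  have hlossm : Measurable (Function.uncurry loss) :=
    (hpair.comp (measurable_snd.prodMk (hfstar.1.comp measurable_snd))).sub
      (hpair.comp (measurable_snd.prodMk hfm))
  have hloss0 : ∀ ω x, 0 ≤ loss ω x := fun ω x => sub_nonneg.2 (hfstar.2 x _)
  have hfω : ∀ ω, Measurable (f n (Z ω)) := fun ω => (hf n).1.comp measurable_prodMk_left
  have hrisk : ∀ ω, risk P (f n (Z ω)) - risk P fstar = ∫ x, loss ω x ∂Q := by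
    intro ω
    have h1 := risk_eq hη hηm (hfω ω)
    have h2 := risk_eq hη hηm hfstar.1
    rw [h1.2, h2.2, integral_sub h2.1 h1.1]
    ring
  have hlossint : ∀ ω, Integrable (loss ω) Q := fun ω =>
    (risk_eq hη hηm hfstar.1).1.sub (risk_eq hη hηm (hfω ω)).1
  have hriskint : Integrable (fun ω => risk P (f n (Z ω))) ρ := by
    have hset : MeasurableSet {q : Ω × (EuclideanSpace ℝ (Fin d) × Fin m) |
        q.2.2 ≠ f n (Z q.1) q.2.1} :=
      (measurableSet_eq_fun (measurable_snd.comp measurable_snd)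
        (hfm.comp (measurable_fst.prodMk (measurable_fst.comp measurable_snd)))).compl
    refine Integrable.of_bound
      (measurable_measure_prodMk_left (ν := P) hset).ennreal_toReal.aestronglyMeasurable 1
      (Eventually.of_forall fun ω => ?_)
    rw [risk, Real.norm_of_nonneg measureReal_nonneg]
    exact measureReal_le_one
  have hexcess : excessRisk ρ P X Y (f n) fstar = ∫ ω, ∫ x, loss ω x ∂Q ∂ρ := by
    simp only [← hrisk]
    rw [integral_sub hriskint (integrable_const _)]
    simp [excessRisk, hZ]
  -- If every estimation error is below `ε * k`, then the loss is below `2 * ε * k`.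
  have hp : ∀ᵐ x ∂Q, ∀ k : ℕ, ρ.real {ω | 2 * ε * k ≤ loss ω x}
      ≤ m * C * Real.exp (-κ * (k : ℝ) ^ 2) := by
    filter_upwards [hQA, hη01'] with x hxA hx01 k
    have hsub : {ω | 2 * ε * k ≤ loss ω x}
        ⊆ ⋃ j : Fin m, {ω | ε * k ≤ |etaHat K h l (fun i : Fin n => (X i ω, Y i ω)) j x
          - η j x|} := by
      intro ω hω
      by_contra hne
      simp only [Set.mem_iUnion, Set.mem_ofPred_eq, not_exists, not_le] at hne
      have h1 := (abs_lt.1 (hne (fstar x))).1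
      have h2 := (abs_lt.1 (hne (f n (Z ω) x))).2
      have h3 := (hf n).2 (Z ω) x (fstar x)
      have h4 : 2 * ε * k ≤ η (fstar x) x - η (f n (Z ω) x) x := hω
      linarith
    refine (measureReal_mono hsub).trans ((measureReal_iUnion_fintype_le _).trans ?_)
    refine (Finset.sum_le_sum fun j _ =>
      htail n hn h hh hr x hxA j (hx01 j) k (Nat.cast_nonneg k)).trans (le_of_eq ?_)
    rw [Finset.sum_const, Finset.card_univ, Fintype.card_fin, nsmul_eq_mul]
    ring
  have hgap : ∀ ω x, 0 < loss ω x → kthLargest (fun j => η j x) ⟨0, by omega⟩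
      - kthLargest (fun j => η j x) ⟨1, by omega⟩ ≤ loss ω x := fun ω x hpos =>
    kthLargest_sub_le (hm := hm) (fun j => η j x) (hfstar.2 x) (sub_pos.1 hpos)
  have hmain := lintegral_loss_le hlossm hε0 hp hgap hMargin
  have hterm : ∀ k : ℕ, ENNReal.ofReal (2 * ε * (k + 1))
      * ENNReal.ofReal (C₀ * (2 * ε * (k + 1)) ^ α)
      * ENNReal.ofReal (m * C * Real.exp (-κ * (k : ℝ) ^ 2))
      = ENNReal.ofReal (ε ^ (1 + α) * S k) := by
    intro k
    have hk : (0 : ℝ) < (k : ℝ) + 1 := by positivity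
    rw [← ENNReal.ofReal_mul (by positivity), ← ENNReal.ofReal_mul (by positivity)]
    congr 1
    simp only [hS]
    rw [Real.mul_rpow (by positivity) hk.le, Real.mul_rpow (by positivity) hε0.le,
      Real.rpow_add hε0, Real.rpow_add hk, Real.rpow_one, Real.rpow_one]
    ring
  simp only [hterm] at hmain
  rw [← ENNReal.ofReal_tsum_of_nonneg (fun k => mul_nonneg (by positivity) (hS0 k))
    (hSsum.mul_left _), tsum_mul_left] at hmain
  have hnonneg : ∀ ω, 0 ≤ ∫ x, loss ω x ∂Q := fun ω => integral_nonneg (hloss0 ω)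
  have hint : Integrable (fun ω => ∫ x, loss ω x ∂Q) ρ := by
    simp only [← hrisk]
    exact hriskint.sub (integrable_const _)
  have hle : ∫ ω, ∫ x, loss ω x ∂Q ∂ρ ≤ ε ^ (1 + α) * ∑' k, S k := by
    rw [integral_eq_lintegral_of_nonneg_ae (Eventually.of_forall hnonneg)
      hint.aestronglyMeasurable]
    refine ENNReal.toReal_le_of_le_ofReal (mul_nonneg (by positivity) (tsum_nonneg hS0)) ?_
    refine le_trans (le_of_eq (lintegral_congr fun ω => ?_)) hmain
    exact ofReal_integral_eq_lintegral_ofReal (hlossint ω) (Eventually.of_forall (hloss0 ω))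
  have hrate : ε ^ (1 + α) = (n : ℝ) ^ (-(β * (1 + α) / (2 * β + d))) := by
    rw [hε, ← Real.rpow_mul hh0.le, bandwidth_rpow hh]
  rw [hexcess, ← hrate]
  refine hle.trans ?_
  rw [mul_comm]
  refine mul_le_mul_of_nonneg_right ?_ (by positivity)
  linarith
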